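/- **Theorem (Verifying the Criteria for Supersolvable Numbers).** A group $G$ is called *supersolvable* if it has a finite chain of subgroups $\{e\} = R_0 \le R_1 \le \dots \le R_r = G$ such that every $R_i$ is normal in $G$ and every quotient $R_{i+1}/R_i$ is cyclic. A positive integer $n$ is called a *supersolvable number* if every group of order $n$ is supersolvable. Let $\psi$ be the multiplicative function given on prime powers by $\psi(p^k) = (p^k-1)(p^{k-1}-1)\cdots(p-1)$. Let $n$ be a positive integer with prime factorization $n = p_1^{a_1}\cdots p_r^{a_r}$, where $p_1 < \dots < p_r$ are primes and all $a_i \ge 1$. Then $n$ is a supersolvable number if and only if both of the following conditions hold. (1) For every $i$, the primes dividing $\gcd(n, \psi(p_i^{a_i}))$ are the same as the primes dividing $\gcd(n, p_i - 1)$. (2) For all $i \ne k$ with $p_i \le a_k$: (a) there is no $j$ with $p_i \mid p_j - 1$ and $p_j \mid p_k - 1$; and (b) $a_i \le 2$, and if $a_i = 2$ then $p_i^2 \mid p_k - 1$. -/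

import Mathlib

universe u

/-- A group `G` is supersolvable if there is a finite chain of subgroups
`1 = R 0 ≤ R 1 ≤ ... ≤ R r = G`, each of them normal in the whole group `G`, such that every
factor `R (i + 1) / R i` is cyclic. -/
def IsSupersolvable (G : Type*) [Group G] : Prop :=
  ∃ (r : ℕ) (R : Fin (r + 1) → Subgroup G) (_ : ∀ i, (R i).Normal),
    R 0 = ⊥ ∧ R (Fin.last r) = ⊤ ∧
      ∀ i : Fin r, R i.castSucc ≤ R i.succ ∧
        IsCyclic (R i.succ ⧸ (R i.castSucc).subgroupOf (R i.succ))

/-- `n` is a supersolvable number if every group of order `n` is supersolvable. -/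
def IsSupersolvableNumber (n : ℕ) : Prop :=
  ∀ (G : Type u) [Group G], Nat.card G = n → IsSupersolvable G

/-- The multiplicative function `ψ` whose value at a prime power `p ^ k` is
`(p ^ k - 1) * (p ^ (k - 1) - 1) * ... * (p - 1)`. -/
def supersolvablePsi (n : ℕ) : ℕ :=
  n.factorization.prod fun p k => ∏ j ∈ Finset.Icc 1 k, (p ^ j - 1)

theorem supersolvablePsi_prime_pow {p : ℕ} (hp : p.Prime) (k : ℕ) :
    supersolvablePsi (p ^ k) = ∏ j ∈ Finset.Icc 1 k, (p ^ j - 1) := by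
  unfold supersolvablePsi
  rw [hp.factorization_pow, Finsupp.prod_single_index]
  simp

/-- The arithmetic condition on `n = p₁ ^ a₁ * ... * pᵣ ^ aᵣ`. Here `p`, `q`, `s` run through the
prime factors of `n`, and `n.factorization p` is the exponent of `p` in `n`. -/
structure SupersolvableCriterion (n : ℕ) : Prop where
  /-- The primes dividing `gcd (n, ψ (p ^ a))` are those dividing `gcd (n, p - 1)`. -/
  psi_condition : ∀ p ∈ n.primeFactors,
    (n.gcd (supersolvablePsi (p ^ n.factorization p))).primeFactors =
      (n.gcd (p - 1)).primeFactors
  /-- If the prime factor `p` is at most the exponent of another prime factor `q`, then no prime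
  factor `s` of `n` has `p ∣ s - 1` and `s ∣ q - 1`. -/
  no_intermediate : ∀ p ∈ n.primeFactors, ∀ q ∈ n.primeFactors, p ≠ q →
    p ≤ n.factorization q → ¬ ∃ s ∈ n.primeFactors, p ∣ s - 1 ∧ s ∣ q - 1
  /-- In the same situation the exponent of `p` is at most `2`, and if it equals `2` then
  `p ^ 2 ∣ q - 1`. -/
  exponent_condition : ∀ p ∈ n.primeFactors, ∀ q ∈ n.primeFactors, p ≠ q →
    p ≤ n.factorization q →
      n.factorization p ≤ 2 ∧ (n.factorization p = 2 → p ^ 2 ∣ q - 1)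

/-! Necessity. In a supersolvable group every nontrivial normal subgroup contains a nontrivial
cyclic subgroup that is normal in the whole group. Hence `V ⋊ H` is not supersolvable when `H` has
no common eigenvector in `V`, and a direct cyclic factor adjusts the order to `n`. Each violation of
the criterion supplies such an action: a cyclic subgroup of the multiplicative group of a field with
`q ^ j` elements acting by multiplication, or a representation of degree `p` over the field with `q`
elements, induced from a non-invariant linear character of `D` to `D ⋊ ℤ/p` (with `D` of order `s`,
or `D ⋊ ℤ/p` a Heisenberg group).

Sufficiency. The criterion passes to divisors, which allows induction on `n`. For the least prime
`p`, normalizers induce only `p`-automorphisms on `p`-subgroups; Frobenius' fusion argument and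
transfer then give `commutator G ≠ ⊤`, so `G` is solvable. A minimal normal subgroup `N` has order
`q ^ d`, and the image `H` of `G` in `MulAut N` is irreducible of smaller order. As the quotients of
`H` are supersolvable, `H` has a self-centralizing abelian normal subgroup `A`. The criterion makes
the exponent of `A` divide `q - 1` and all primes dividing its index exceed `d`. So `A` is
diagonalizable with at most `d` weights, which `H` permutes and must therefore fix; by
irreducibility `A` is scalar, so `H = A` and `N` is cyclic (`isCyclic_of_irreducible`). Induction on
`G ⧸ N` finishes. -/

/-! ### Supersolvable groups and cyclic normal subgroups. -/

theorem isCyclic_quotient_subgroupOf_iff {G : Type*} [Group G] (A B : Subgroup G) [A.Normal] :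
    IsCyclic (B ⧸ A.subgroupOf B) ↔ ∃ x ∈ B, ∀ y ∈ B, ∃ k : ℤ, (x ^ k)⁻¹ * y ∈ A := by
  constructor
  · rintro ⟨⟨g, hg⟩⟩
    obtain ⟨x, rfl⟩ := QuotientGroup.mk_surjective g
    refine ⟨x, x.2, fun y hy => ?_⟩
    obtain ⟨k, hk⟩ := hg ((⟨y, hy⟩ : B) : B ⧸ A.subgroupOf B)
    refine ⟨k, ?_⟩
    have hk' : ((x ^ k : B) : B ⧸ A.subgroupOf B) = ((⟨y, hy⟩ : B) : B ⧸ A.subgroupOf B) := hk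
    rw [QuotientGroup.eq] at hk'
    simpa [Subgroup.mem_subgroupOf] using hk'
  · rintro ⟨x, hx, h⟩
    refine ⟨⟨((⟨x, hx⟩ : B) : B ⧸ A.subgroupOf B), fun g => ?_⟩⟩
    obtain ⟨y, rfl⟩ := QuotientGroup.mk_surjective g
    obtain ⟨k, hk⟩ := h y y.2
    refine ⟨k, ?_⟩
    change (((⟨x, hx⟩ : B) ^ k : B) : B ⧸ A.subgroupOf B) = _
    rw [QuotientGroup.eq]
    simpa [Subgroup.mem_subgroupOf] using hk

theorem IsSupersolvable.of_subsingleton {G : Type*} [Group G] [Subsingleton G] :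
    IsSupersolvable G :=
  ⟨0, fun _ => ⊥, fun _ => inferInstance, rfl, Subsingleton.elim _ _, fun i => i.elim0⟩

theorem IsSupersolvable.of_isCyclic_of_quotient {G : Type*} [Group G] (N : Subgroup G) [N.Normal]
    [hN : IsCyclic N] (h : IsSupersolvable (G ⧸ N)) : IsSupersolvable G := by
  obtain ⟨r, R, hR, h0, h1, hc⟩ := h
  let R' : Fin (r + 2) → Subgroup G :=
    Fin.cases ⊥ (fun i => (R i).comap (QuotientGroup.mk' N))
  have hR' : ∀ i, (R' i).Normal := by
    intro i
    refine Fin.cases ?_ (fun j => ?_) i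
    · exact inferInstanceAs (⊥ : Subgroup G).Normal
    · exact (hR j).comap _
  refine ⟨r + 1, R', hR', rfl, ?_, fun i => ?_⟩
  · change (R (Fin.last r)).comap (QuotientGroup.mk' N) = ⊤
    rw [h1, Subgroup.comap_top]
  · rw [isCyclic_quotient_subgroupOf_iff]
    refine Fin.cases ?_ (fun j => ?_) i
    · refine ⟨bot_le, ?_⟩
      change ∃ x ∈ (R 0).comap (QuotientGroup.mk' N), ∀ y ∈ (R 0).comap (QuotientGroup.mk' N),
        ∃ k : ℤ, (x ^ k)⁻¹ * y ∈ (⊥ : Subgroup G)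
      rw [h0, MonoidHom.comap_bot, QuotientGroup.ker_mk']
      obtain ⟨⟨g, hg⟩⟩ := hN
      refine ⟨g, g.2, fun y hy => ?_⟩
      obtain ⟨k, hk⟩ := hg ⟨y, hy⟩
      refine ⟨k, ?_⟩
      have := congrArg Subtype.val hk
      simp only [SubgroupClass.coe_zpow] at this
      simp [this]
    · obtain ⟨hle, hcy⟩ := hc j
      rw [isCyclic_quotient_subgroupOf_iff] at hcy
      obtain ⟨x, hx, h⟩ := hcy
      obtain ⟨x, rfl⟩ := QuotientGroup.mk_surjective x
      change (R j.castSucc).comap (QuotientGroup.mk' N) ≤ (R j.succ).comap (QuotientGroup.mk' N) ∧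
        ∃ x ∈ (R j.succ).comap (QuotientGroup.mk' N),
        ∀ y ∈ (R j.succ).comap (QuotientGroup.mk' N),
        ∃ k : ℤ, (x ^ k)⁻¹ * y ∈ (R j.castSucc).comap (QuotientGroup.mk' N)
      exact ⟨Subgroup.comap_mono hle, x, hx, fun y hy => h y hy⟩

/-- The first term of the series that meets `N` nontrivially does so in a normal subgroup embedding
in the corresponding cyclic factor. -/
theorem IsSupersolvable.exists_zpowers_normal {G : Type*} [Group G] (h : IsSupersolvable G)
    (N : Subgroup G) [N.Normal] (hN : N ≠ ⊥) :
    ∃ x ∈ N, x ≠ 1 ∧ (Subgroup.zpowers x).Normal := by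
  obtain ⟨r, R, hR, h0, h1, hc⟩ := h
  have key : ∀ i : Fin (r + 1), R i ⊓ N = ⊥ ∨ ∃ x ∈ N, x ≠ 1 ∧ (Subgroup.zpowers x).Normal := by
    intro i
    induction i using Fin.induction with
    | zero => left; rw [h0, bot_inf_eq]
    | succ i ih =>
      obtain ih | ih := ih
      swap
      · exact Or.inr ih
      by_cases hb : R i.succ ⊓ N = ⊥
      · exact Or.inl hb
      right
      obtain ⟨hle, hcy⟩ := hc i
      set M := R i.succ ⊓ N with hM
      have hMn : M.Normal := inferInstance
      let f : M →* (R i.succ ⧸ (R i.castSucc).subgroupOf (R i.succ)) :=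
        (QuotientGroup.mk' _).comp (Subgroup.inclusion (inf_le_left : M ≤ R i.succ))
      have hf : Function.Injective f := by
        rw [injective_iff_map_eq_one]
        intro a ha
        have ha' : (a : G) ∈ R i.castSucc := by
          have := (QuotientGroup.eq_one_iff _).1 ha
          simpa [Subgroup.mem_subgroupOf] using this
        have : (a : G) ∈ R i.castSucc ⊓ N := ⟨ha', a.2.2⟩
        rw [ih, Subgroup.mem_bot] at this
        exact Subtype.ext this
      have : IsCyclic M := isCyclic_of_injective f hf
      obtain ⟨g, hg⟩ := (Subgroup.isCyclic_iff_exists_zpowers_eq_top M).1 this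
      refine ⟨g, ?_, ?_, ?_⟩
      · exact (hg ▸ Subgroup.mem_zpowers g : g ∈ M).2
      · rintro rfl
        exact hb (by rw [← hg, Subgroup.zpowers_one_eq_bot])
      · rw [hg]; exact hMn
  rcases key (Fin.last r) with h | h
  · rw [h1, top_inf_eq] at h
    exact absurd h hN
  · exact h

/-! ### Necessity: actions without common eigenvectors. -/

/-- A generator of a normal cyclic subgroup inside the copy of `V` would be a common eigenvector of
`H`, which `hφ` excludes. -/
theorem not_isSupersolvable_semidirectProduct_prod {V H C : Type*} [Group V] [Group H] [Group C]
    [Nontrivial V] (φ : H →* MulAut V)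
    (hφ : ∀ v, (∀ h, φ h v ∈ Subgroup.zpowers v) → v = 1) :
    ¬ IsSupersolvable ((V ⋊[φ] H) × C) := by
  intro hs
  let N : Subgroup ((V ⋊[φ] H) × C) :=
    MonoidHom.ker ((SemidirectProduct.rightHom (φ := φ)).prodMap (MonoidHom.id C))
  have hmem : ∀ x, x ∈ N ↔ x.1.right = 1 ∧ x.2 = 1 := fun x => by
    rw [MonoidHom.mem_ker]
    simp [Prod.ext_iff]
  have hN : N ≠ ⊥ := by
    obtain ⟨v, hv⟩ := exists_ne (1 : V)
    intro h
    have h1 : ((SemidirectProduct.inl v : V ⋊[φ] H), (1 : C)) ∈ N := by simp [hmem]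
    rw [h, Subgroup.mem_bot] at h1
    have := congrArg (fun x => x.1.left) h1
    exact hv (by simpa using this)
  obtain ⟨⟨x, c⟩, hx, hx1, hn⟩ := hs.exists_zpowers_normal N hN
  obtain ⟨hr, hc⟩ := (hmem _).1 hx
  dsimp only at hr hc
  obtain ⟨v, w⟩ := x
  dsimp only at hr
  subst hr hc
  have hv : v = 1 := by
    refine hφ v fun h => ?_
    obtain ⟨k, hk⟩ := hn.conj_mem _ (Subgroup.mem_zpowers _)
      ((SemidirectProduct.inr h : V ⋊[φ] H), (1 : C))
    refine ⟨k, ?_⟩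
    have h2 := congrArg (fun x => x.1.left) hk
    have h3 : ∀ v : V, (⟨v, 1⟩ : V ⋊[φ] H) = SemidirectProduct.inl v := fun v => rfl
    simpa [h3, ← map_zpow] using h2
  subst hv
  exact hx1 rfl

/-- The factor `ZMod m` pads the order to `n`, and `ULift` moves the product to universe `u`. -/
theorem not_isSupersolvableNumber_of_mulAut {V H : Type} [Group V] [Group H] [Finite V] [Finite H]
    [Nontrivial V] (φ : H →* MulAut V) (hφ : ∀ v, (∀ h, φ h v ∈ Subgroup.zpowers v) → v = 1)
    {n : ℕ} (hdvd : Nat.card V * Nat.card H ∣ n) : ¬ IsSupersolvableNumber.{u} n := by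
  obtain ⟨m, rfl⟩ := hdvd
  intro h
  refine not_isSupersolvable_semidirectProduct_prod (C := ULift.{u} (Multiplicative (ZMod m))) φ hφ
    (h _ ?_)
  have h1 : Nat.card (V ⋊[φ] H) = Nat.card V * Nat.card H := by
    rw [Nat.card_congr SemidirectProduct.equivProd, Nat.card_prod]
  have h2 : Nat.card (ULift.{u} (Multiplicative (ZMod m))) = m := by
    rw [Nat.card_congr Equiv.ulift]
    exact Nat.card_zmod m
  rw [Nat.card_prod, h1, h2]

/-- If `q ^ j - 1` has a divisor `e` not dividing `q - 1`, the cyclic group of order `e` acts on the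
field with `q ^ j` elements without eigenvectors over the prime field. -/
theorem not_isSupersolvableNumber_of_dvd_pow_sub_one {q j e n : ℕ} (hq : q.Prime) (hj : j ≠ 0)
    (he : e ∣ q ^ j - 1) (he' : ¬ e ∣ q - 1) (hn : q ^ j * e ∣ n) :
    ¬ IsSupersolvableNumber.{u} n := by
  have : Fact q.Prime := ⟨hq⟩
  let F := GaloisField q j
  have : Fintype F := Fintype.ofFinite F
  have hF : Nat.card F = q ^ j := GaloisField.card q j hj
  have hU : Nat.card Fˣ = q ^ j - 1 := by rw [Nat.card_units, hF]
  obtain ⟨w, hw⟩ : ∃ w : Fˣ, orderOf w = e := by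
    obtain ⟨g, hg⟩ := IsCyclic.exists_ofOrder_eq_natCard (α := Fˣ)
    rw [hU] at hg
    obtain ⟨c, hc⟩ := he
    have hpos : 0 < q ^ j - 1 := hU ▸ Nat.card_pos
    refine ⟨g ^ c, ?_⟩
    rw [orderOf_pow, hg, hc, Nat.gcd_mul_left_left]
    exact Nat.mul_div_cancel _ (Nat.pos_of_ne_zero (by rintro rfl; omega))
  let φ : Subgroup.zpowers w →* MulAut (Multiplicative F) :=
    { toFun := fun u =>
        { toFun := fun v => Multiplicative.ofAdd ((u : Fˣ) * v.toAdd)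
          invFun := fun v => Multiplicative.ofAdd (((u : Fˣ)⁻¹ : Fˣ) * v.toAdd)
          left_inv := fun v => by simp
          right_inv := fun v => by simp
          map_mul' := fun a b => by simp [mul_add] }
      map_one' := by ext v; simp
      map_mul' := fun a b => by ext v; simp [mul_assoc] }
  refine not_isSupersolvableNumber_of_mulAut φ (fun v hv => ?_) (n := n) ?_
  · obtain ⟨k, hk⟩ := hv ⟨w, Subgroup.mem_zpowers w⟩
    have hk' : ((k : ℤ) : F) * v.toAdd = (w : F) * v.toAdd := by
      have := congrArg Multiplicative.toAdd hk
      simpa [φ] using this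
    by_contra hne
    have hv0 : v.toAdd ≠ 0 := fun h => hne (by simpa using h)
    -- An eigenvector forces `w` into the prime field, whence `w ^ (q - 1) = 1` and `e ∣ q - 1`.
    have hkw := mul_right_cancel₀ hv0 hk'
    apply he'
    rw [← hw, orderOf_dvd_iff_pow_eq_one]
    have hk0 : (k : ZMod q) ≠ 0 := by
      intro h0
      have : (k : F) = 0 := by
        rw [← map_intCast (algebraMap (ZMod q) F), h0, map_zero]
      exact w.ne_zero (hkw ▸ this)
    have h1 := congrArg (algebraMap (ZMod q) F) (ZMod.pow_card_sub_one_eq_one hk0)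
    simp only [map_pow, map_intCast, map_one] at h1
    ext
    rw [Units.val_pow_eq_pow_val, ← hkw, h1, Units.val_one]
  · rw [Nat.card_zpowers, hw]
    change Nat.card F * e ∣ n
    rwa [hF]

/-- Induction of a linear character `χ` of `D` to `D ⋊ ℤ/p` gives an action without common
eigenvectors unless `χ` is invariant. -/
theorem not_isSupersolvableNumber_of_character {p q n : ℕ} (hp : p.Prime) (hq : q.Prime)
    {D : Type} [Group D] [Finite D] (σ : Multiplicative (ZMod p) →* MulAut D)
    (χ : D →* (ZMod q)ˣ) (hχ : ∃ t d, χ (σ t d) ≠ χ d)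
    (hn : q ^ p * (Nat.card D * p) ∣ n) : ¬ IsSupersolvableNumber.{u} n := by
  have : Fact q.Prime := ⟨hq⟩
  have : Fact p.Prime := ⟨hp⟩
  -- The induced module in coordinates: `d` acts diagonally with entry `χ (σ i d)` at `i`, and `ℤ/p`
  -- translates the coordinates.
  let V := Multiplicative (Multiplicative (ZMod p) → ZMod q)
  let f₁ : D →* MulAut V :=
    { toFun := fun d =>
        { toFun := fun v => Multiplicative.ofAdd (fun i => (χ (σ i d) : ZMod q) * v.toAdd i)
          invFun := fun v =>
            Multiplicative.ofAdd (fun i => (((χ (σ i d))⁻¹ : (ZMod q)ˣ) : ZMod q) * v.toAdd i)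
          left_inv := fun v => funext fun i => Units.inv_mul_cancel_left (χ (σ i d)) (v.toAdd i)
          right_inv := fun v => funext fun i => Units.mul_inv_cancel_left (χ (σ i d)) (v.toAdd i)
          map_mul' := fun a b => funext fun i => mul_add (χ (σ i d) : ZMod q) (a.toAdd i) (b.toAdd i) }
      map_one' := MulEquiv.ext fun v => funext fun i => by
        change (χ (σ i 1) : ZMod q) * v.toAdd i = v.toAdd i
        rw [map_one, map_one, Units.val_one, one_mul]
      map_mul' := fun a b => MulEquiv.ext fun v => funext fun i => by
        change (χ (σ i (a * b)) : ZMod q) * v.toAdd i = χ (σ i a) * (χ (σ i b) * v.toAdd i)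
        rw [map_mul, map_mul, Units.val_mul, mul_assoc] }
  let f₂ : Multiplicative (ZMod p) →* MulAut V :=
    { toFun := fun t =>
        { toFun := fun v => Multiplicative.ofAdd (fun i => v.toAdd (i * t))
          invFun := fun v => Multiplicative.ofAdd (fun i => v.toAdd (i * t⁻¹))
          left_inv := fun v => funext fun i => congrArg v.toAdd (inv_mul_cancel_right i t)
          right_inv := fun v => funext fun i => congrArg v.toAdd (mul_inv_cancel_right i t)
          map_mul' := fun a b => rfl }
      map_one' := MulEquiv.ext fun v => funext fun i => congrArg v.toAdd (mul_one i)
      map_mul' := fun a b => MulEquiv.ext fun v => funext fun i =>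
        congrArg v.toAdd (mul_assoc i a b).symm }
  have hf₁ : ∀ d (v : V) i, (f₁ d v).toAdd i = (χ (σ i d) : ZMod q) * v.toAdd i :=
    fun _ _ _ => rfl
  have hf₂ : ∀ t (v : V) i, (f₂ t v).toAdd i = v.toAdd (i * t) := fun _ _ _ => rfl
  have hc : ∀ t, f₁.comp (σ t).toMonoidHom = (MulAut.conj (f₂ t)).toMonoidHom.comp f₁ := by
    intro t
    ext d v : 2
    apply Multiplicative.toAdd.injective
    funext i
    change (f₁ (σ t d) v).toAdd i = (f₂ t (f₁ d ((f₂ t)⁻¹ v))).toAdd i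
    rw [← map_inv, hf₂, hf₁, hf₁, hf₂, mul_inv_cancel_right, map_mul, MulAut.mul_apply]
  have : Finite (D ⋊[σ] Multiplicative (ZMod p)) :=
    Finite.of_equiv _ SemidirectProduct.equivProd.symm
  refine not_isSupersolvableNumber_of_mulAut (SemidirectProduct.lift f₁ f₂ hc)
    (fun v hv => ?_) (n := n) ?_
  · have h1 : ∀ d, ∃ k : ℤ, ∀ i, (k : ZMod q) * v.toAdd i = (χ (σ i d) : ZMod q) * v.toAdd i := by
      intro d
      obtain ⟨k, hk⟩ := hv (SemidirectProduct.inl d)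
      refine ⟨k, fun i => ?_⟩
      rw [← hf₁]
      rw [SemidirectProduct.lift_inl] at hk
      have := congrFun (congrArg Multiplicative.toAdd hk) i
      exact (zsmul_eq_mul (v.toAdd i) k).symm.trans this
    have h2 : ∀ t, ∃ k : ℤ, ∀ i, (k : ZMod q) * v.toAdd i = v.toAdd (i * t) := by
      intro t
      obtain ⟨k, hk⟩ := hv (SemidirectProduct.inr t)
      refine ⟨k, fun i => ?_⟩
      rw [← hf₂]
      rw [SemidirectProduct.lift_inr] at hk
      have := congrFun (congrArg Multiplicative.toAdd hk) i
      exact (zsmul_eq_mul (v.toAdd i) k).symm.trans this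
    by_contra hne
    obtain ⟨i, hi⟩ : ∃ i, v.toAdd i ≠ 0 := by
      by_contra! h
      exact hne (Multiplicative.toAdd.injective (funext h))
    -- Translations are transitive on coordinates, so an eigenvector has no zero coordinate. All
    -- diagonal entries of `d` then coincide, in particular those at `t` and `1`.
    have h3 : ∀ t, v.toAdd t ≠ 0 := by
      intro t ht
      obtain ⟨k, hk⟩ := h2 (t⁻¹ * i)
      have := hk t
      rw [ht, mul_zero, mul_inv_cancel_left] at this
      exact hi this.symm
    obtain ⟨t, d, htd⟩ := hχ
    obtain ⟨k, hk⟩ := h1 d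
    apply htd
    have e1 := mul_right_cancel₀ (h3 t) (hk t)
    have e2 := mul_right_cancel₀ (h3 1) (hk 1)
    ext
    rw [← e1, e2]
    simp
  · have h1 : Nat.card (D ⋊[σ] Multiplicative (ZMod p)) = Nat.card D * p := by
      rw [Nat.card_congr SemidirectProduct.equivProd, Nat.card_prod]
      congr 1
      exact Nat.card_zmod p
    have h2 : Nat.card V = q ^ p := by
      change Nat.card (Multiplicative (ZMod p) → ZMod q) = _
      rw [Nat.card_fun, Nat.card_zmod]
      congr 1
      exact Nat.card_zmod p
    rwa [h1, h2]

/-! ### Arithmetic of the criterion. -/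

/-- The working form of the condition on `ψ`: each `p ^ j - 1` with `1 ≤ j ≤ n.factorization p` is a
factor of `ψ`. The next lemma is the converse. -/
theorem SupersolvableCriterion.dvd_sub_one {n : ℕ} (h : SupersolvableCriterion n) {p r j : ℕ}
    (hp : p ∈ n.primeFactors) (hr : r ∈ n.primeFactors) (hj : j ≠ 0) (hjn : j ≤ n.factorization p)
    (hd : r ∣ p ^ j - 1) : r ∣ p - 1 := by
  have hp' := Nat.prime_of_mem_primeFactors hp
  have hr' := Nat.prime_of_mem_primeFactors hr
  have h1 : r ∈ (n.gcd (supersolvablePsi (p ^ n.factorization p))).primeFactors := by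
    rw [Nat.mem_primeFactors]
    refine ⟨hr', Nat.dvd_gcd (Nat.dvd_of_mem_primeFactors hr) ?_, ?_⟩
    · rw [supersolvablePsi_prime_pow hp']
      exact hd.trans (Finset.dvd_prod_of_mem _ (Finset.mem_Icc.2 ⟨by omega, hjn⟩))
    · exact (Nat.gcd_pos_of_pos_left _ (Nat.pos_of_ne_zero (Nat.mem_primeFactors.1 hp).2.2)).ne'
  rw [h.psi_condition p hp] at h1
  exact (Nat.dvd_of_mem_primeFactors h1).trans (Nat.gcd_dvd_right _ _)

theorem psi_condition_of_dvd_sub_one {n : ℕ} {p : ℕ} (hp : p ∈ n.primeFactors)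
    (h : ∀ r ∈ n.primeFactors, ∀ j ≠ 0, j ≤ n.factorization p → r ∣ p ^ j - 1 → r ∣ p - 1) :
    (n.gcd (supersolvablePsi (p ^ n.factorization p))).primeFactors =
      (n.gcd (p - 1)).primeFactors := by
  have hp' := Nat.prime_of_mem_primeFactors hp
  have hn : n ≠ 0 := (Nat.mem_primeFactors.1 hp).2.2
  have hgcd : ∀ m, n.gcd m ≠ 0 := fun m => (Nat.gcd_pos_of_pos_left _ (Nat.pos_of_ne_zero hn)).ne'
  ext r
  simp only [Nat.mem_primeFactors, Nat.dvd_gcd_iff, hgcd, ne_eq, not_false_eq_true, and_true]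
  refine and_congr_right fun hr => and_congr_right fun hrn => ?_
  rw [supersolvablePsi_prime_pow hp']
  constructor
  · intro hd
    obtain ⟨j, hj, hd⟩ := (hr.prime.dvd_finsetProd_iff _).1 hd
    obtain ⟨hj1, hj2⟩ := Finset.mem_Icc.1 hj
    exact h r (Nat.mem_primeFactors.2 ⟨hr, hrn, hn⟩) j (by omega) hj2 hd
  · intro hd
    have h1 : 1 ≤ n.factorization p := hp'.factorization_pos_of_dvd hn
      (Nat.dvd_of_mem_primeFactors hp)
    refine hd.trans ?_
    have := Finset.dvd_prod_of_mem (fun j => p ^ j - 1)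
      (Finset.mem_Icc.2 ⟨le_refl 1, h1⟩)
    simpa using this

/-- This heredity drives both inductions of the sufficiency proof. Exponents only drop, and an
exponent `2` in `m` forces exponent `2` in `n` because larger ones are excluded there. -/
theorem SupersolvableCriterion.of_dvd {m n : ℕ} (h : SupersolvableCriterion n) (hn : n ≠ 0)
    (hmn : m ∣ n) : SupersolvableCriterion m := by
  have hm : m ≠ 0 := ne_zero_of_dvd_ne_zero hn hmn
  have hsub := Nat.primeFactors_mono hmn hn
  have hle : ∀ p, m.factorization p ≤ n.factorization p :=
    (Nat.factorization_le_iff_dvd hm hn).2 hmn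
  refine ⟨fun p hp => psi_condition_of_dvd_sub_one hp fun r hr j hj hjm hd =>
    h.dvd_sub_one (hsub hp) (hsub hr) hj (hjm.trans (hle p)) hd, ?_, ?_⟩
  · rintro p hp q hq hpq hpa ⟨s, hs, h1⟩
    exact h.no_intermediate p (hsub hp) q (hsub hq) hpq (hpa.trans (hle q)) ⟨s, hsub hs, h1⟩
  · intro p hp q hq hpq hpa
    obtain ⟨h1, h2⟩ := h.exponent_condition p (hsub hp) q (hsub hq) hpq (hpa.trans (hle q))
    exact ⟨(hle p).trans h1, fun he => h2 (le_antisymm h1 (he ▸ hle p))⟩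

/-! ### Necessity: a group for each violated condition. -/

theorem Nat.Prime.dvd_pow_pred_sub_one {p q : ℕ} (hp : p.Prime) (hq : q.Prime) (hpq : p ≠ q) :
    p ∣ q ^ (p - 1) - 1 := by
  have h : q.Coprime p := (Nat.coprime_primes hq hp).2 hpq.symm
  have := (Nat.ModEq.pow_totient h).symm
  rw [Nat.totient_prime hp] at this
  exact (Nat.modEq_iff_dvd' (Nat.one_le_pow _ _ hq.pos)).1 this

/-- In `q ^ p - 1 = (1 + q + ⋯ + q ^ (p - 1)) * (q - 1)` the sum is congruent to `p`, hence to `0`,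
modulo `p`. -/
theorem mul_dvd_pow_sub_one_of_dvd_sub_one {p q : ℕ} (hq : 0 < q) (h : p ∣ q - 1) :
    p ^ 2 ∣ q ^ p - 1 := by
  obtain ⟨c, hc⟩ := h
  obtain rfl : q = p * c + 1 := by omega
  have h2 : (∑ i ∈ Finset.range p, (p * c + 1) ^ i) ≡ ∑ i ∈ Finset.range p, 1 [MOD p] := by
    refine Nat.ModEq.sum fun i _ => ?_
    have : p * c + 1 ≡ 1 [MOD p] := by simp [Nat.ModEq]
    simpa using this.pow i
  have h3 : p ∣ ∑ i ∈ Finset.range p, (p * c + 1) ^ i := by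
    rw [← Nat.modEq_zero_iff_dvd]
    refine h2.trans ?_
    simp [Nat.ModEq]
  have h4 := geom_sum_mul_add (p * c) p
  have h5 : (p * c + 1) ^ p - 1 = (∑ i ∈ Finset.range p, (p * c + 1) ^ i) * (p * c) := by omega
  rw [h5, pow_two]
  exact mul_dvd_mul h3 (dvd_mul_right _ _)

theorem exists_hom_zmod_apply_eq {p : ℕ} {M : Type*} [Group M] (f : M) (hf : f ^ p = 1) :
    ∃ σ : Multiplicative (ZMod p) →* M, ∃ t, σ t = f := by
  have h0 : zmultiplesHom (Additive M) (Additive.ofMul f) (p : ℤ) = 0 := by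
    simp [← ofMul_pow, hf]
  refine ⟨AddMonoidHom.toMultiplicativeLeft (ZMod.lift p ⟨zmultiplesHom _ (Additive.ofMul f), h0⟩),
    Multiplicative.ofAdd ((1 : ℤ) : ZMod p), ?_⟩
  change (ZMod.lift p ⟨zmultiplesHom _ (Additive.ofMul f), h0⟩ ((1 : ℤ) : ZMod p)).toMul = f
  rw [ZMod.lift_coe]
  simp

theorem exists_units_zmod_orderOf_eq {e q : ℕ} (hq : q.Prime) (he : e.Prime) (h : e ∣ q - 1) :
    ∃ w : (ZMod q)ˣ, orderOf w = e := by
  have : Fact q.Prime := ⟨hq⟩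
  have : Fact e.Prime := ⟨he⟩
  refine exists_prime_orderOf_dvd_card' e ?_
  rwa [Nat.card_eq_fintype_card, ZMod.card_units]

/-- The automorphism `(a, b) ↦ (a, a * b)` of `C × C`. -/
def shearMulAut (C : Type*) [CommGroup C] : MulAut (C × C) where
  toFun x := (x.1, x.1 * x.2)
  invFun x := (x.1, x.1⁻¹ * x.2)
  left_inv x := by simp
  right_inv x := by simp
  map_mul' x y := by
    ext
    · rfl
    · exact mul_mul_mul_comm _ _ _ _

theorem shearMulAut_pow_apply {C : Type*} [CommGroup C] (k : ℕ) (x : C × C) :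
    (shearMulAut C ^ k) x = (x.1, x.1 ^ k * x.2) := by
  induction k with
  | zero => simp
  | succ k ih =>
    rw [pow_succ', MulAut.mul_apply, ih]
    change (x.1, x.1 * (x.1 ^ k * x.2)) = _
    rw [pow_succ', mul_assoc]

/-- Here `D` is the group of order `s` inside `(ZMod q)ˣ` and `χ` its inclusion. Being faithful, `χ`
is moved by any automorphism of order `p`. -/
theorem not_isSupersolvableNumber_of_no_intermediate {p q s n : ℕ} (hp : p.Prime) (hq : q.Prime)
    (hs : s.Prime) (hps : p ∣ s - 1) (hsq : s ∣ q - 1) (hn : q ^ p * (s * p) ∣ n) :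
    ¬ IsSupersolvableNumber.{u} n := by
  have : Fact p.Prime := ⟨hp⟩
  have : Fact s.Prime := ⟨hs⟩
  obtain ⟨w, hw⟩ := exists_units_zmod_orderOf_eq hq hs hsq
  have : Fact q.Prime := ⟨hq⟩
  have hc : Nat.card (Subgroup.zpowers w) = s := by rw [Nat.card_zpowers, hw]
  have hA : Nat.card (MulAut (Subgroup.zpowers w)) = s - 1 := by
    rw [Nat.card_congr (IsCyclic.mulAutMulEquiv (Subgroup.zpowers w)).toEquiv, hc,
      Nat.card_eq_fintype_card, ZMod.card_units]
  obtain ⟨f, hf⟩ := exists_prime_orderOf_dvd_card' (G := MulAut (Subgroup.zpowers w)) p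
    (hA ▸ hps)
  obtain ⟨σ, t, hσ⟩ := exists_hom_zmod_apply_eq f (hf ▸ pow_orderOf_eq_one f)
  refine not_isSupersolvableNumber_of_character hp hq σ (Subgroup.subtype _) ?_ (by rwa [hc])
  refine ⟨t, ?_⟩
  by_contra! h
  have : f = 1 := MulEquiv.ext fun d => Subtype.ext (hσ ▸ h d)
  rw [this, orderOf_one] at hf
  exact hp.one_lt.ne hf

/-- The shear turns `C × C` into the Heisenberg group of order `p ^ 3`; it does not preserve the
second projection, which is taken as the character. -/
theorem not_isSupersolvableNumber_of_heisenberg {p q n : ℕ} (hp : p.Prime) (hq : q.Prime)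
    (hpq : p ∣ q - 1) (hn : q ^ p * p ^ 3 ∣ n) : ¬ IsSupersolvableNumber.{u} n := by
  obtain ⟨w, hw⟩ := exists_units_zmod_orderOf_eq hq hp hpq
  have : Fact q.Prime := ⟨hq⟩
  let C := Subgroup.zpowers w
  have hc : Nat.card C = p := by rw [Nat.card_zpowers, hw]
  obtain ⟨σ, t, hσ⟩ := exists_hom_zmod_apply_eq (p := p) (shearMulAut C) <| MulEquiv.ext fun x => by
    rw [shearMulAut_pow_apply, ← hc, pow_card_eq_one', one_mul]
    rfl
  refine not_isSupersolvableNumber_of_character hp hq σ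
    ((Subgroup.subtype C).comp (MonoidHom.snd C C)) ?_ ?_
  · refine ⟨t, (⟨w, Subgroup.mem_zpowers w⟩, 1), fun h => ?_⟩
    rw [hσ] at h
    have : w = 1 := by simpa [shearMulAut] using h
    rw [this, orderOf_one] at hw
    exact hp.one_lt.ne hw
  · rw [Nat.card_prod, hc]
    convert hn using 2
    ring

theorem SupersolvableCriterion.of_isSupersolvableNumber {n : ℕ} (hn : n ≠ 0)
    (h : IsSupersolvableNumber.{u} n) : SupersolvableCriterion n := by
  have key : ∀ p ∈ n.primeFactors, ∀ r ∈ n.primeFactors, ∀ j ≠ 0, j ≤ n.factorization p →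
      r ∣ p ^ j - 1 → r ∣ p - 1 := by
    intro p hp r hr j hj hjn hd
    by_contra hne
    have hp' := Nat.prime_of_mem_primeFactors hp
    have hr' := Nat.prime_of_mem_primeFactors hr
    refine not_isSupersolvableNumber_of_dvd_pow_sub_one hp' hj hd hne ?_ h
    refine Nat.Coprime.mul_dvd_of_dvd_of_dvd (Nat.Coprime.pow_left _ ?_)
      ((hp'.pow_dvd_iff_le_factorization hn).2 hjn) (Nat.dvd_of_mem_primeFactors hr)
    refine (Nat.coprime_primes hp' hr').2 ?_
    rintro rfl
    have h1 : p ∣ p ^ j := dvd_pow_self p hj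
    have h2 := (Nat.dvd_sub_iff_right (Nat.one_le_pow _ _ hp'.pos) h1).1 hd
    exact hp'.one_lt.ne' (Nat.dvd_one.1 h2)
  -- Fermat gives `p ∣ q ^ (p - 1) - 1`, and the exponent `p - 1` is within the range of `key`.
  have key2 : ∀ p ∈ n.primeFactors, ∀ q ∈ n.primeFactors, p ≠ q → p ≤ n.factorization q →
      p ∣ q - 1 := by
    intro p hp q hq hpq hle
    have hp' := Nat.prime_of_mem_primeFactors hp
    have := hp'.two_le
    exact key q hq p hp (p - 1) (by omega) (by omega)
      (hp'.dvd_pow_pred_sub_one (Nat.prime_of_mem_primeFactors hq) hpq)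
  refine ⟨fun p hp => psi_condition_of_dvd_sub_one hp (key p hp), ?_, ?_⟩
  · rintro p hp q hq hpq hle ⟨s, hs, h1, h2⟩
    have hp' := Nat.prime_of_mem_primeFactors hp
    have hq' := Nat.prime_of_mem_primeFactors hq
    have hs' := Nat.prime_of_mem_primeFactors hs
    have l1 := Nat.le_of_dvd (Nat.sub_pos_of_lt hs'.one_lt) h1
    have l2 := Nat.le_of_dvd (Nat.sub_pos_of_lt hq'.one_lt) h2
    have := hs'.two_le
    have := hq'.two_le
    refine not_isSupersolvableNumber_of_no_intermediate hp' hq' hs' h1 h2 ?_ h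
    refine Nat.Coprime.mul_dvd_of_dvd_of_dvd (Nat.Coprime.pow_left _ (Nat.Coprime.mul_right ?_ ?_))
      ((hq'.pow_dvd_iff_le_factorization hn).2 hle)
      (Nat.Coprime.mul_dvd_of_dvd_of_dvd ?_ (Nat.dvd_of_mem_primeFactors hs)
        (Nat.dvd_of_mem_primeFactors hp))
    · exact (Nat.coprime_primes hq' hs').2 (by omega)
    · exact (Nat.coprime_primes hq' hp').2 hpq.symm
    · exact (Nat.coprime_primes hs' hp').2 (by omega)
  · intro p hp q hq hpq hle
    have hp' := Nat.prime_of_mem_primeFactors hp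
    have hq' := Nat.prime_of_mem_primeFactors hq
    have hdvd := key2 p hp q hq hpq hle
    have hmul : ∀ k, k ≤ n.factorization p → q ^ p * p ^ k ∣ n := fun k hk =>
      Nat.Coprime.mul_dvd_of_dvd_of_dvd (Nat.coprime_pow_primes _ _ hq' hp' hpq.symm)
        ((hq'.pow_dvd_iff_le_factorization hn).2 hle)
        ((hp'.pow_dvd_iff_le_factorization hn).2 hk)
    constructor
    · by_contra hlt
      exact not_isSupersolvableNumber_of_heisenberg hp' hq' hdvd (hmul 3 (by omega)) h
    · intro h2
      by_contra hne
      -- The cyclic group of order `p ^ 2` acts on the field with `q ^ p` elements.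
      exact not_isSupersolvableNumber_of_dvd_pow_sub_one hq' hp'.ne_zero
        (mul_dvd_pow_sub_one_of_dvd_sub_one hq'.pos hdvd) hne (hmul 2 h2.ge) h

/-! ### Orders of automorphisms of groups of prime power order. -/

theorem exists_orderOf_prime_of_not_isPGroup {G : Type*} [Group G] [Finite G] {p : ℕ}
    (h : ¬ IsPGroup p G) (hp : p.Prime) : ∃ r, r.Prime ∧ r ≠ p ∧ ∃ g : G, orderOf g = r := by
  by_contra! hne
  have : Fact p.Prime := ⟨hp⟩
  apply h
  rw [IsPGroup.iff_card]
  have := Nat.eq_prime_pow_of_unique_prime_dvd (n := Nat.card G) (p := p) Nat.card_pos.ne' ?_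
  · exact ⟨_, this⟩
  · intro r hr hd
    have : Fact r.Prime := ⟨hr⟩
    by_contra hrp
    obtain ⟨g, hg⟩ := exists_prime_orderOf_dvd_card' r hd
    exact hne r hr hrp g hg

/-- An automorphism of prime order `r ≠ p` of a group of order `p ^ k` moves `p ^ k - p ^ c` points,
in cycles of length `r`. -/
theorem exists_dvd_pow_sub_one_of_orderOf_mulAut {X : Type*} [Group X] [Finite X] {p r k : ℕ}
    (hp : p.Prime) (hr : r.Prime) (hrp : r ≠ p) (hX : Nat.card X = p ^ k) (f : MulAut X)
    (hf : orderOf f = r) : ∃ j, j ≠ 0 ∧ j ≤ k ∧ r ∣ p ^ j - 1 := by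
  have : Fact r.Prime := ⟨hr⟩
  have hZ : IsPGroup r (Subgroup.zpowers f) := IsPGroup.of_card (n := 1) (by simp [hf])
  have h1 := hZ.card_modEq_card_fixedPoints X
  let F : Subgroup X := f.toMonoidHom.eqLocus (MonoidHom.id X)
  have hF : MulAction.fixedPoints (Subgroup.zpowers f) X = F := by
    ext x
    constructor
    · intro h
      exact h ⟨f, Subgroup.mem_zpowers f⟩
    · rintro h ⟨g, n, rfl⟩
      have h2 : f ∈ MulAction.stabilizer (MulAut X) x := h
      exact Subgroup.zpow_mem _ h2 n
  obtain ⟨c, hc, hFc⟩ := (Nat.dvd_prime_pow hp).1 (hX ▸ F.card_subgroup_dvd_card)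
  have hck : c ≠ k := by
    rintro rfl
    have : F = ⊤ := F.eq_top_of_card_eq (hFc.trans hX.symm)
    have : f = 1 := MulEquiv.ext fun x => (this ▸ Subgroup.mem_top x : x ∈ F)
    rw [this, orderOf_one] at hf
    exact hr.one_lt.ne hf
  rw [hF, hX] at h1
  change p ^ k ≡ Nat.card F [MOD r] at h1
  rw [hFc] at h1
  have h2 := (Nat.modEq_iff_dvd' (Nat.pow_le_pow_right hp.pos hc)).1 h1.symm
  refine ⟨k - c, by omega, by omega, ?_⟩
  have h3 : p ^ k - p ^ c = p ^ c * (p ^ (k - c) - 1) := by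
    rw [Nat.mul_sub, ← pow_add, Nat.add_sub_cancel' hc, mul_one]
  rw [h3] at h2
  exact (((Nat.coprime_primes hr hp).2 hrp).pow_right c).dvd_of_dvd_mul_left h2

/-- If `z = f ^ p ^ t ≠ 1` has order `p`, the group generated by `f` acts freely outside of the fixed
points of `z`. -/
theorem exists_prime_pow_dvd_pow_sub_one_of_orderOf_mulAut {X : Type*} [Group X] [Finite X]
    {p q k t : ℕ} (hp : p.Prime) (hq : q.Prime) (hpq : p ≠ q) (hX : Nat.card X = q ^ k)
    (f : MulAut X) (hf : orderOf f = p ^ (t + 1)) :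
    ∃ j, j ≠ 0 ∧ j ≤ k ∧ p ^ (t + 1) ∣ q ^ j - 1 := by
  have : Fact p.Prime := ⟨hp⟩
  let z := f ^ p ^ t
  have hz : z ≠ 1 := by
    intro h
    have := orderOf_dvd_of_pow_eq_one h
    rw [hf, Nat.pow_dvd_pow_iff_le_right hp.one_lt] at this
    omega
  let F : Subgroup X := z.toMonoidHom.eqLocus (MonoidHom.id X)
  have hmem : ∀ x, x ∈ F ↔ z x = x := fun x => Iff.rfl
  obtain ⟨c, hc, hFc⟩ := (Nat.dvd_prime_pow hq).1 (hX ▸ F.card_subgroup_dvd_card)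
  have hck : c ≠ k := by
    rintro rfl
    have : F = ⊤ := F.eq_top_of_card_eq (hFc.trans hX.symm)
    exact hz (MulEquiv.ext fun x => (this ▸ Subgroup.mem_top x : x ∈ F))
  have hcomm : ∀ g ∈ Subgroup.zpowers f, ∀ x, x ∈ F → g x ∈ F := by
    rintro g ⟨n, rfl⟩ x hx
    rw [hmem] at hx ⊢
    change (z * f ^ n) x = (f ^ n) x
    rw [((Commute.refl f).pow_left _).zpow_right n |>.eq, MulAut.mul_apply]
    exact congrArg _ hx
  let A : SubMulAction (Subgroup.zpowers f) X :=
    { carrier := (F : Set X)ᶜ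
      smul_mem' := fun g x hx h => hx <| by
        have := hcomm _ (inv_mem g.2) _ h
        change (((g : MulAut X)⁻¹ * g) x) ∈ F at this
        rwa [inv_mul_cancel] at this }
  -- Every nontrivial subgroup of the cyclic `p`-group generated by `f` contains `z`, which fixes no
  -- point of `A`. Concretely, if `f ^ n ≠ 1` fixes `a`, so does `f ^ gcd (n, p ^ (t + 1)) = f ^ p ^
  -- s` with `s ≤ t`.
  have hstab : ∀ a : A, MulAction.stabilizer (Subgroup.zpowers f) a = ⊥ := by
    rintro ⟨a, ha⟩
    rw [Subgroup.eq_bot_iff_forall]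
    rintro ⟨g, hg⟩ hga
    obtain ⟨n, rfl⟩ := (Submonoid.mem_powers_iff _ _).1 (mem_powers_iff_mem_zpowers.2 hg)
    have h1 : f ^ n ∈ MulAction.stabilizer (MulAut X) a := congrArg Subtype.val hga
    by_contra hne
    have h2 : ¬ p ^ (t + 1) ∣ n := fun h => hne <| Subtype.ext <| by
      rw [← hf] at h
      exact orderOf_dvd_iff_pow_eq_one.1 h
    obtain ⟨s, hs, hsg⟩ := (Nat.dvd_prime_pow hp).1 (Nat.gcd_dvd_right n (p ^ (t + 1)))
    have hst : s ≤ t := by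
      by_contra hlt
      obtain rfl : s = t + 1 := by omega
      exact h2 (hsg ▸ Nat.gcd_dvd_left n (p ^ (t + 1)))
    refine ha (?_ : z ∈ MulAction.stabilizer (MulAut X) a)
    have h3 : z = (f ^ (p ^ s)) ^ p ^ (t - s) := by
      rw [← pow_mul, ← pow_add, Nat.add_sub_cancel' hst]
    rw [h3]
    refine Subgroup.pow_mem _ ?_ _
    rw [← hsg, ← zpow_natCast, Nat.gcd_eq_gcd_ab, zpow_add, zpow_mul, zpow_mul, zpow_natCast,
      zpow_natCast, ← hf, pow_orderOf_eq_one, one_zpow, mul_one]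
    exact Subgroup.zpow_mem _ h1 _
  have hA : Nat.card A = q ^ k - q ^ c := by
    classical
    have := Nat.card_congr (Equiv.Set.sumCompl (F : Set X))
    rw [Nat.card_sum, hX] at this
    change Nat.card F + Nat.card A = _ at this
    omega
  have hd : p ^ (t + 1) ∣ Nat.card A := by
    rw [← hf, ← Nat.card_zpowers,
      Nat.card_congr (MulAction.selfEquivOrbitsQuotientProd hstab), Nat.card_prod]
    exact dvd_mul_left _ _
  refine ⟨k - c, by omega, by omega, ?_⟩
  have h3 : q ^ k - q ^ c = q ^ c * (q ^ (k - c) - 1) := by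
    rw [Nat.mul_sub, ← pow_add, Nat.add_sub_cancel' hc, mul_one]
  rw [hA, h3] at hd
  exact (Nat.coprime_pow_primes _ _ hp hq hpq).dvd_of_dvd_mul_left hd

/-! ### Frobenius' fusion argument and transfer. -/

theorem IsPGroup.exists_mem_normalizer_notMem {G : Type*} [Group G] [Finite G] {p : ℕ}
    [Fact p.Prime] {P D : Subgroup G} (hP : IsPGroup p P) (h : D < P) :
    ∃ a ∈ P, a ∉ D ∧ a ∈ Subgroup.normalizer (D : Set G) := by
  have : Group.IsNilpotent P := hP.isNilpotent
  have h1 := Group.normalizerCondition_of_isNilpotent (G := P) (D.subgroupOf P) (by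
    rw [lt_top_iff_ne_top, ne_eq, Subgroup.subgroupOf_eq_top]
    exact h.not_ge)
  obtain ⟨a, ha, haD⟩ := SetLike.exists_of_lt h1
  refine ⟨a, a.2, fun h => haD (Subgroup.mem_subgroupOf.2 h), ?_⟩
  rw [Subgroup.mem_normalizer_iff] at ha ⊢
  intro x
  by_cases hx : x ∈ P
  · simpa [Subgroup.mem_subgroupOf] using ha ⟨x, hx⟩
  · constructor
    · intro h2
      exact absurd (h.le h2) hx
    · intro h2
      refine absurd ?_ hx
      have h3 := P.mul_mem (P.mul_mem (P.inv_mem a.2) (h.le h2)) a.2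
      simpa [mul_assoc] using h3

open Pointwise in
theorem Sylow.mem_smul_iff {G : Type*} [Group G] {p : ℕ} {P : Sylow p G} {g x : G} :
    x ∈ g • P ↔ g⁻¹ * x * g ∈ P := by
  change x ∈ ((g • P : Sylow p G) : Subgroup G) ↔ g⁻¹ * x * g ∈ (P : Subgroup G)
  rw [Sylow.coe_subgroup_smul, Subgroup.mem_pointwise_smul_iff_inv_smul_mem, ← map_inv,
    MulAut.smul_def, MulAut.conj_apply, inv_inv]

/-- Every element normalizing a `p`-subgroup induces an automorphism of `p`-power order on it. -/
def IsFrobeniusAt (p : ℕ) (G : Type*) [Group G] : Prop :=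
  ∀ X : Subgroup G, IsPGroup p X → ∀ g ∈ Subgroup.normalizer (X : Set G),
    ∃ k : ℕ, g ^ p ^ k ∈ Subgroup.centralizer (X : Set G)

namespace IsFrobeniusAt

variable {G : Type*} [Group G] [Finite G] {p : ℕ} [Fact p.Prime]

/-- The normalizer modulo the centralizer `C` is a `p`-group, so the index of `S ⊔ C` is a power of
`p`; it is also prime to `p`, as `S` is Sylow. -/
theorem exists_eq_mul (hF : IsFrobeniusAt p G) {D : Subgroup G} (hD : IsPGroup p D)
    (S : Sylow p (Subgroup.normalizer (D : Set G))) (n : Subgroup.normalizer (D : Set G)) :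
    ∃ s ∈ S, ∃ c : Subgroup.normalizer (D : Set G), (c : G) ∈ Subgroup.centralizer (D : Set G) ∧
      n = s * c := by
  let C := (Subgroup.centralizer (D : Set G)).subgroupOf (Subgroup.normalizer (D : Set G))
  have hC : C.Normal := inferInstance
  have hp : IsPGroup p (Subgroup.normalizer (D : Set G) ⧸ C) := by
    intro g
    obtain ⟨g, rfl⟩ := QuotientGroup.mk_surjective g
    obtain ⟨k, hk⟩ := hF D hD g g.2
    exact ⟨k, (QuotientGroup.eq_one_iff _).2 (Subgroup.mem_subgroupOf.2 hk)⟩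
  obtain ⟨k, hk⟩ := IsPGroup.iff_card.1 hp
  have h1 : ((S : Subgroup _) ⊔ C).index ∣ p ^ k := by
    rw [← hk, ← Subgroup.index_eq_card]
    exact Subgroup.index_dvd_of_le le_sup_right
  have h2 : ¬ p ∣ ((S : Subgroup _) ⊔ C).index := fun h =>
    S.not_dvd_index (h.trans (Subgroup.index_dvd_of_le le_sup_left))
  have h3 : ((S : Subgroup _) ⊔ C) = ⊤ := by
    obtain ⟨j, -, hj⟩ := (Nat.dvd_prime_pow Fact.out).1 h1
    rw [← Subgroup.index_eq_one, hj]
    rcases j with _ | j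
    · rfl
    · exact absurd (hj ▸ dvd_pow_self p (Nat.succ_ne_zero j)) h2
  obtain ⟨s, hs, c, hc, h⟩ := Subgroup.mem_sup_of_normal_right.1 (h3 ▸ Subgroup.mem_top n)
  exact ⟨s, hs, c, Subgroup.mem_subgroupOf.1 hc, h.symm⟩

/-- `A` and `B` lie in Sylow subgroups `S`, `T` of the normalizer of `D`. A conjugator from `T` to
`S` factors as `s * c` with `s ∈ S`, and `s` can be dropped since it normalizes `S`. -/
theorem exists_sylow_le_smul (hF : IsFrobeniusAt p G) {D A B : Subgroup G} (hD : IsPGroup p D)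
    (hA : IsPGroup p A) (hB : IsPGroup p B) (hAN : A ≤ Subgroup.normalizer (D : Set G))
    (hBN : B ≤ Subgroup.normalizer (D : Set G)) :
    ∃ R : Sylow p G, ∃ c ∈ Subgroup.centralizer (D : Set G),
      A ≤ R ∧ B ≤ ((c • R : Sylow p G) : Subgroup G) := by
  set N := Subgroup.normalizer (D : Set G) with hN
  obtain ⟨S, hS⟩ := (hA.comap_subtype (K := N)).exists_le_sylow
  obtain ⟨T, hT⟩ := (hB.comap_subtype (K := N)).exists_le_sylow
  obtain ⟨n, hn⟩ := MulAction.exists_smul_eq N T S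
  obtain ⟨s, hs, c, hc, rfl⟩ := hF.exists_eq_mul hD S n
  obtain ⟨R, hR⟩ := (S.2.map N.subtype).exists_le_sylow
  refine ⟨R, (c : G)⁻¹, inv_mem hc, fun a ha => ?_, fun b hb => ?_⟩
  · exact hR ⟨⟨a, hAN ha⟩, hS (Subgroup.mem_subgroupOf.2 ha), rfl⟩
  · have h1 : c • T = S := by
      rw [mul_smul] at hn
      rw [eq_inv_smul_iff.2 hn, Sylow.smul_eq_iff_mem_normalizer]
      exact Subgroup.le_normalizer (inv_mem hs)
    refine Sylow.mem_smul_iff.2 (hR ⟨c * ⟨b, hBN hb⟩ * c⁻¹, ?_, by simp⟩)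
    change _ ∈ S
    rw [← h1, Sylow.mem_smul_iff]
    simp only [mul_assoc, inv_mul_cancel_left, inv_mul_cancel, mul_one]
    exact hT (Subgroup.mem_subgroupOf.2 hb)

/-- Sylow subgroups are conjugate under the centralizer of their intersection. -/
theorem exists_mem_centralizer_smul_eq (hF : IsFrobeniusAt p G) (P Q : Sylow p G) :
    ∃ c ∈ Subgroup.centralizer ((P ⊓ Q : Subgroup G) : Set G), c • P = Q := by
  -- Induction towards larger intersections.
  induction hm : Nat.card G - Nat.card (P ⊓ Q : Subgroup G) using Nat.strong_induction_on
    generalizing P Q with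
  | _ m ih =>
  by_cases hPQ : P = Q
  · subst hPQ
    exact ⟨1, one_mem _, one_smul _ _⟩
  subst hm
  set D : Subgroup G := P ⊓ Q with hDdef
  have hDP : D < P := by
    refine lt_of_le_of_ne inf_le_left fun h => hPQ ?_
    exact Sylow.ext (P.3 Q.2 (h ▸ inf_le_right)).symm
  have hDQ : D < Q := by
    refine lt_of_le_of_ne inf_le_right fun h => hPQ ?_
    exact Sylow.ext (Q.3 P.2 (h ▸ inf_le_left))
  have hlt : ∀ E : Subgroup G, D < E → Nat.card G - Nat.card E < Nat.card G - Nat.card D := by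
    intro E hE
    have h1 : Nat.card D < Nat.card E := Set.Finite.card_lt_card (Set.toFinite _) hE
    have h2 := E.card_le_card_group
    omega
  obtain ⟨a, haP, haD, haN⟩ := P.2.exists_mem_normalizer_notMem hDP
  obtain ⟨b, hbQ, hbD, hbN⟩ := Q.2.exists_mem_normalizer_notMem hDQ
  have hD : IsPGroup p D := P.2.to_le hDP.le
  -- As normalizers grow in `p`-groups, `P ⊓ R` and `c • R ⊓ Q` are larger than `D`. The chain `P`,
  -- `R`, `c • R`, `Q` is thus linked by elements centralizing `D`.
  obtain ⟨R, c, hc, hA, hB⟩ := hF.exists_sylow_le_smul hD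
    (P.2.to_le (inf_le_left : (P : Subgroup G) ⊓ Subgroup.normalizer (D : Set G) ≤ P))
    (Q.2.to_le (inf_le_left : (Q : Subgroup G) ⊓ Subgroup.normalizer (D : Set G) ≤ Q))
    inf_le_right inf_le_right
  have h1 : D < (P : Subgroup G) ⊓ R :=
    lt_of_le_of_ne (le_inf hDP.le ((le_inf hDP.le Subgroup.le_normalizer).trans hA))
      fun h => haD (h ▸ ⟨haP, hA ⟨haP, haN⟩⟩)
  have h2 : D < ((c • R : Sylow p G) : Subgroup G) ⊓ Q :=
    lt_of_le_of_ne (le_inf ((le_inf hDQ.le Subgroup.le_normalizer).trans hB) hDQ.le)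
      fun h => hbD (h ▸ ⟨hB ⟨hbQ, hbN⟩, hbQ⟩)
  obtain ⟨x, hx, hxP⟩ := ih _ (hlt _ h1) P R rfl
  obtain ⟨y, hy, hyR⟩ := ih _ (hlt _ h2) (c • R) Q rfl
  refine ⟨y * (c * x), mul_mem (Subgroup.centralizer_le h2.le hy)
    (mul_mem hc (Subgroup.centralizer_le h1.le hx)), ?_⟩
  rw [mul_smul, mul_smul, hxP, hyR]

/-- A Sylow subgroup controls its own fusion. -/
theorem exists_mem_conj_eq (hF : IsFrobeniusAt p G) (P : Sylow p G) {x g : G} (hx : x ∈ P)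
    (hg : g⁻¹ * x * g ∈ P) : ∃ u ∈ P, g⁻¹ * x * g = u⁻¹ * x * u := by
  -- Since `c` centralizes `g⁻¹ * x * g`, conjugation by `g` and by `g * c` agree on `x`. The latter
  -- element normalizes `P`, so it is `s * d` with `s ∈ P` and `d` centralizing `P`.
  obtain ⟨c, hc, hcP⟩ := hF.exists_mem_centralizer_smul_eq P (g⁻¹ • P)
  have hy : g⁻¹ * x * g ∈ (P ⊓ (g⁻¹ • P : Sylow p G) : Subgroup G) := by
    refine ⟨hg, Sylow.mem_smul_iff.2 ?_⟩
    simpa [mul_assoc] using hx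
  have h1 := (Subgroup.mem_centralizer_iff.1 hc) _ hy
  have hn : g * c ∈ Subgroup.normalizer (P : Set G) := by
    rw [← Sylow.smul_eq_iff_mem_normalizer, mul_smul, hcP, smul_inv_smul]
  obtain ⟨s, hs, d, hd, hsd⟩ := hF.exists_eq_mul P.2 (P.subtype Subgroup.le_normalizer) ⟨g * c, hn⟩
  have hs' : (s : G) ∈ P := hs
  have hsd' : g * c = s * d := congrArg Subtype.val hsd
  refine ⟨s, hs', ?_⟩
  have h2 := (Subgroup.mem_centralizer_iff.1 hd) _
    (P.mul_mem (P.mul_mem (P.inv_mem hs') hx) hs')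
  calc g⁻¹ * x * g = c⁻¹ * (c * (g⁻¹ * x * g)) := (inv_mul_cancel_left _ _).symm
    _ = (g * c)⁻¹ * x * (g * c) := by rw [← h1]; group
    _ = (d : G)⁻¹ * ((s : G)⁻¹ * x * s * d) := by rw [hsd']; group
    _ = (s : G)⁻¹ * x * s := by rw [h2, inv_mul_cancel_left]

/-- By fusion control, the transfer to the abelianization of a Sylow subgroup `P` sends `x ∈ P` to
the class of `x ^ P.index`. If `G` were perfect this would be trivial; the index being prime to `p`,
`P` would be perfect, which is absurd for a nontrivial `p`-group. -/
theorem commutator_ne_top (hF : IsFrobeniusAt p G) (hp : p ∣ Nat.card G) : commutator G ≠ ⊤ := by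
  intro htop
  obtain ⟨P⟩ : Nonempty (Sylow p G) := inferInstance
  let ϕ : P →* Abelianization P := Abelianization.of
  have h1 : ∀ x : P, ϕ x ^ (P : Subgroup G).index = 1 := by
    classical
    intro x
    have h0 : MonoidHom.transfer ϕ (x : G) = 1 :=
      Abelianization.commutator_subset_ker (MonoidHom.transfer ϕ) (htop ▸ Subgroup.mem_top _)
    let := (P : Subgroup G).fintypeQuotientOfFiniteIndex
    rw [← h0, MonoidHom.transfer_eq_prod_quotient_orbitRel_zpowers_quot,
      Subgroup.index_eq_sum_minimalPeriod (P : Subgroup G) (x : G), ← Finset.prod_pow_eq_pow_sum]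
    refine Finset.prod_congr rfl fun q _ => ?_
    have hmem := QuotientGroup.out_conj_pow_minimalPeriod_mem (P : Subgroup G) (x : G) q.out
    obtain ⟨u, hu, h⟩ := hF.exists_mem_conj_eq P (P.pow_mem x.2 _) hmem
    have h2 : (⟨_, hmem⟩ : P) =
        (⟨u, hu⟩ : P)⁻¹ * x ^ Function.minimalPeriod ((x : G) • ·) q.out * ⟨u, hu⟩ := Subtype.ext h
    rw [h2, map_mul, map_mul, map_inv, mul_comm (ϕ _)⁻¹, inv_mul_cancel_right, map_pow]
  obtain ⟨k, hk⟩ := IsPGroup.iff_card.1 P.2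
  have h2 : ∀ x : P, ϕ x = 1 := by
    intro x
    have h3 : ϕ x ^ p ^ k = 1 := by
      rw [← map_pow, ← hk]
      exact (congrArg ϕ (pow_card_eq_one' (x := x))).trans (map_one ϕ)
    have hcop : Nat.Coprime (P : Subgroup G).index (p ^ k) :=
      (((Nat.Prime.coprime_iff_not_dvd Fact.out).2 P.not_dvd_index).pow_left k).symm
    have := Nat.dvd_gcd (orderOf_dvd_of_pow_eq_one (h1 x)) (orderOf_dvd_of_pow_eq_one h3)
    rw [hcop.gcd_eq_one] at this
    exact orderOf_eq_one_iff.1 (Nat.dvd_one.1 this)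
  have : Group.IsNilpotent P := P.2.isNilpotent
  have : Nontrivial P := by
    have := P.ne_bot_of_dvd_card hp
    exact (Subgroup.nontrivial_iff_ne_bot _).2 this
  refine (Group.IsSolvable.commutator_lt_top_of_nontrivial P).ne (top_unique fun x _ => ?_)
  rw [← Abelianization.ker_of]
  exact h2 x

end IsFrobeniusAt

/-! ### Solvability from the criterion. -/

theorem SupersolvableCriterion.dvd_sub_one_of_orderOf_mulAut {n : ℕ}
    (h : SupersolvableCriterion n) {p r : ℕ} (hp : p ∈ n.primeFactors) (hr : r ∈ n.primeFactors)
    (hrp : r ≠ p) {X : Type*} [Group X] [Finite X] {k : ℕ} (hX : Nat.card X = p ^ k)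
    (hk : k ≤ n.factorization p) (f : MulAut X) (hf : orderOf f = r) : r ∣ p - 1 := by
  obtain ⟨j, hj, hjk, hd⟩ := exists_dvd_pow_sub_one_of_orderOf_mulAut
    (Nat.prime_of_mem_primeFactors hp) (Nat.prime_of_mem_primeFactors hr) hrp hX f hf
  exact h.dvd_sub_one hp hr hj (hjk.trans hk) hd

theorem SupersolvableCriterion.mulAut_eq_one {n : ℕ} (h : SupersolvableCriterion n) {p r : ℕ}
    (hp : p ∈ n.primeFactors) (hr : r ∈ n.primeFactors) (hrp : r ≠ p) (hnd : ¬ r ∣ p - 1)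
    {X : Type*} [Group X] [Finite X] {k : ℕ} (hX : Nat.card X = p ^ k)
    (hk : k ≤ n.factorization p) (f : MulAut X) {t : ℕ} (hf : f ^ r ^ t = 1) : f = 1 := by
  have hr' := Nat.prime_of_mem_primeFactors hr
  by_contra hne
  obtain ⟨s, -, hs⟩ := (Nat.dvd_prime_pow hr').1 (orderOf_dvd_of_pow_eq_one hf)
  rcases s with _ | s
  · rw [pow_zero, orderOf_eq_one_iff] at hs
    exact hne hs
  · refine hnd (h.dvd_sub_one_of_orderOf_mulAut hp hr hrp hX hk (f ^ r ^ s) ?_)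
    rw [orderOf_pow_of_dvd (pow_ne_zero _ hr'.ne_zero) (hs ▸ pow_dvd_pow r (Nat.le_succ s)), hs,
      pow_succ, Nat.mul_div_cancel_left _ (pow_pos hr'.pos s)]

theorem Nat.Prime.le_factorization_of_card_eq {G : Type*} [Group G] [Finite G] {p k n : ℕ}
    (hp : p.Prime) (hn : n ≠ 0) (hG : Nat.card G = p ^ k) (hd : Nat.card G ∣ n) :
    k ≤ n.factorization p :=
  (hp.pow_dvd_iff_le_factorization hn).1 (hG ▸ hd)

/-- Otherwise some prime `r ≠ p` dividing the group order is the order of an induced automorphism of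
a `p`-subgroup; the criterion gives `r ∣ p - 1`, against the minimality of `p`. -/
theorem SupersolvableCriterion.isFrobeniusAt_minFac {G : Type*} [Group G] [Finite G]
    [Nontrivial G] (h : SupersolvableCriterion (Nat.card G)) :
    IsFrobeniusAt (Nat.card G).minFac G := by
  have hn1 : Nat.card G ≠ 1 := Finite.one_lt_card.ne'
  have hn0 : Nat.card G ≠ 0 := Nat.card_pos.ne'
  have hp := Nat.minFac_prime hn1
  have hpm : (Nat.card G).minFac ∈ (Nat.card G).primeFactors :=
    Nat.mem_primeFactors.2 ⟨hp, Nat.minFac_dvd _, hn0⟩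
  set p := (Nat.card G).minFac with hpdef
  have : Fact p.Prime := ⟨hp⟩
  intro X hX g hg
  obtain ⟨k, hk⟩ := IsPGroup.iff_card.1 hX
  let φ := X.normalizerMonoidHom
  have hR : IsPGroup p φ.range := by
    by_contra hne
    obtain ⟨r, hr, hrp, f, hf⟩ := exists_orderOf_prime_of_not_isPGroup hne hp
    have hrn : r ∣ Nat.card G := by
      rw [← hf]
      exact (orderOf_dvd_natCard f).trans
        ((Subgroup.card_range_dvd φ).trans (Subgroup.card_subgroup_dvd_card _))
    have h1 := h.dvd_sub_one_of_orderOf_mulAut hpm (Nat.mem_primeFactors.2 ⟨hr, hrn, hn0⟩) hrp hk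
      (hp.le_factorization_of_card_eq hn0 hk X.card_subgroup_dvd_card) f
      (by rw [Subgroup.orderOf_coe, hf])
    have h2 := Nat.le_of_dvd (Nat.sub_pos_of_lt hp.one_lt) h1
    have h3 := Nat.minFac_le_of_dvd hr.two_le hrn
    have := hp.two_le
    omega
  obtain ⟨j, hj⟩ := hR ⟨φ ⟨g, hg⟩, ⟨g, hg⟩, rfl⟩
  refine ⟨j, ?_⟩
  have h1 : (⟨g, hg⟩ : Subgroup.normalizer (X : Set G)) ^ p ^ j ∈ φ.ker := by
    rw [MonoidHom.mem_ker, map_pow]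
    exact congrArg Subtype.val hj
  rw [Subgroup.normalizerMonoidHom_ker] at h1
  exact Subgroup.mem_subgroupOf.1 h1

theorem SupersolvableCriterion.isSolvable {n : ℕ} (h : SupersolvableCriterion n) (hn : n ≠ 0)
    (G : Type*) [Group G] (hG : Nat.card G = n) : Group.IsSolvable G := by
  induction n using Nat.strong_induction_on generalizing G with
  | _ n ih =>
  have : Finite G := Nat.finite_of_card_ne_zero (hG ▸ hn)
  cases subsingleton_or_nontrivial G
  · infer_instance
  · subst hG
    have hp := Nat.minFac_prime (Finite.one_lt_card (α := G)).ne'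
    have : Fact (Nat.card G).minFac.Prime := ⟨hp⟩
    have h1 := h.isFrobeniusAt_minFac.commutator_ne_top (Nat.minFac_dvd _)
    have h2 : Nat.card (commutator G) < Nat.card G := by
      refine lt_of_le_of_ne (Subgroup.card_le_card_group _) fun h => h1 ?_
      exact Subgroup.eq_top_of_card_eq _ h
    have : Group.IsSolvable (commutator G) :=
      ih _ h2 (h.of_dvd hn (Subgroup.card_subgroup_dvd_card _)) Nat.card_pos.ne' _ rfl
    refine Group.isSolvable_of_ker_le_range (commutator G).subtype
      (Abelianization.of (G := G)) ?_
    rw [Abelianization.ker_of, Subgroup.range_subtype]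

/-- A nontrivial solvable group has an abelian normal subgroup that is minimal normal. -/
theorem exists_isMulCommutative_minimal_normal (G : Type*) [Group G] [Finite G] [Nontrivial G]
    [hs : Group.IsSolvable G] : ∃ N : Subgroup G, N.Normal ∧ N ≠ ⊥ ∧ IsMulCommutative N ∧
      ∀ M : Subgroup G, M.Normal → M ≤ N → M = ⊥ ∨ M = N := by
  obtain ⟨N, hN⟩ := (Set.toFinite {N : Subgroup G | N.Normal ∧ N ≠ ⊥}).exists_minimal
    ⟨⊤, inferInstance, top_ne_bot⟩
  obtain ⟨hn, hb⟩ := hN.prop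
  have hmin : ∀ M : Subgroup G, M.Normal → M ≤ N → M = ⊥ ∨ M = N := by
    intro M hM hle
    by_contra! h
    exact h.2 (hle.antisymm (hN.le_of_le ⟨hM, h.1⟩ hle))
  refine ⟨N, hn, hb, ?_, hmin⟩
  rw [← Subgroup.le_centralizer_iff_isMulCommutative, ← Subgroup.commutator_eq_bot_iff_le_centralizer]
  -- If `N` were perfect, it would lie in every term of the derived series.
  refine (hmin ⁅N, N⁆ inferInstance (Subgroup.commutator_le_right N N)).resolve_right fun h => ?_
  obtain ⟨k, hk⟩ := hs.solvable
  have h1 : ∀ k, N ≤ derivedSeries G k := by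
    intro k
    induction k with
    | zero => exact le_top
    | succ k ih =>
      rw [derivedSeries_succ]
      calc N = ⁅N, N⁆ := h.symm
        _ ≤ _ := Subgroup.commutator_mono ih ih
  exact hb (le_bot_iff.1 (hk ▸ h1 k))

/-! ### Centralizing abelian normal subgroups. -/

theorem Subgroup.eq_top_of_forall_exists_sylow_le {G : Type*} [Group G] [Finite G] (C : Subgroup G)
    (h : ∀ s : ℕ, s.Prime → s ∣ Nat.card G → ∃ P : Sylow s G, (P : Subgroup G) ≤ C) : C = ⊤ := by
  by_contra hne
  rw [← Subgroup.index_eq_one] at hne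
  have hs := Nat.minFac_prime hne
  have : Fact C.index.minFac.Prime := ⟨hs⟩
  obtain ⟨P, hP⟩ := h _ hs ((Nat.minFac_dvd _).trans C.index_dvd_card)
  exact P.not_dvd_index ((Nat.minFac_dvd _).trans (Subgroup.index_dvd_of_le hP))

/-- The Sylow subgroups of the abelian group `A` generate it and are characteristic in it, hence
normal in `G`. -/
theorem Subgroup.mem_centralizer_of_forall_isPGroup {G : Type*} [Group G] [Finite G]
    (A : Subgroup G) [A.Normal] [IsMulCommutative A] (x : G)
    (h : ∀ s : ℕ, s.Prime → s ∣ Nat.card A → ∀ X : Subgroup G, X.Normal → X ≤ A → IsPGroup s X →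
      ∀ a ∈ X, a * x = x * a) : x ∈ Subgroup.centralizer (A : Set G) := by
  have hC : (Subgroup.centralizer {x}).subgroupOf A = ⊤ := by
    refine Subgroup.eq_top_of_forall_exists_sylow_le _ fun s hs hsA => ?_
    have : Fact s.Prime := ⟨hs⟩
    obtain ⟨P⟩ : Nonempty (Sylow s A) := inferInstance
    have hPn : (P : Subgroup A).Normal := ⟨fun a ha g => by
      rwa [mul_comm' g a, mul_inv_cancel_right]⟩
    have := P.characteristic_of_normal hPn
    refine ⟨P, fun a ha => ?_⟩
    rw [Subgroup.mem_subgroupOf, Subgroup.mem_centralizer_singleton_iff]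
    exact h s hs hsA ((P : Subgroup A).map A.subtype) inferInstance
      (Subgroup.map_subtype_le _) (P.2.map _) a ⟨a, ha, rfl⟩
  rw [Subgroup.mem_centralizer_iff]
  intro a ha
  have := Subgroup.mem_subgroupOf.1 (hC ▸ Subgroup.mem_top (⟨a, ha⟩ : A))
  exact Subgroup.mem_centralizer_singleton_iff.1 this

/-- On an `s`-part with `s ≠ p`, `x` acts with `p`-power order, hence trivially because `p ∤ s - 1`.
The `p`-part together with `x` generates a group of order at most `p ^ 2`, which is abelian. -/
theorem SupersolvableCriterion.mem_centralizer {n : ℕ} (hc : SupersolvableCriterion n) (hn : n ≠ 0)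
    {G : Type*} [Group G] [Finite G] (hG : Nat.card G ∣ n) (A : Subgroup G) [A.Normal]
    [IsMulCommutative A] {p t : ℕ} (hp : p.Prime) (hpn : p ∣ n)
    (hps : ∀ s : ℕ, s.Prime → s ∣ Nat.card A → s ≠ p → ¬ p ∣ s - 1)
    (hpp : p ∣ Nat.card A → n.factorization p ≤ 2) {x : G} (hx : x ^ p ^ t = 1) :
    x ∈ Subgroup.centralizer (A : Set G) := by
  refine A.mem_centralizer_of_forall_isPGroup x fun s hs hsA X hXn hXA hX a ha => ?_
  have : Fact s.Prime := ⟨hs⟩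
  obtain ⟨k, hk⟩ := IsPGroup.iff_card.1 hX
  by_cases hsp : s = p
  · subst hsp
    have hZ : IsPGroup s (Subgroup.zpowers x) := by
      obtain ⟨j, -, hj⟩ := (Nat.dvd_prime_pow hs).1 (orderOf_dvd_of_pow_eq_one hx)
      exact IsPGroup.of_card (n := j) (by rw [Nat.card_zpowers, hj])
    have hP : IsPGroup s (X ⊔ Subgroup.zpowers x : Subgroup G) := hX.to_sup_of_normal_left hZ
    obtain ⟨j, hj⟩ := IsPGroup.iff_card.1 hP
    have hj2 : j ≤ 2 := (hs.le_factorization_of_card_eq hn hj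
      ((Subgroup.card_subgroup_dvd_card _).trans hG)).trans (hpp hsA)
    have hcomm : ∀ a b : (X ⊔ Subgroup.zpowers x : Subgroup G), a * b = b * a := by
      interval_cases j
      · have := (Nat.card_eq_one_iff_unique.1 hj).1
        exact fun a b => Subsingleton.elim _ _
      · have : IsCyclic (X ⊔ Subgroup.zpowers x : Subgroup G) :=
          isCyclic_of_prime_card (hj.trans (pow_one s))
        exact fun a b => mul_comm' a b
      · exact isMulCommutative_iff.1 (IsPGroup.isMulCommutative_of_card_eq_prime_sq hj)
    exact congrArg Subtype.val (hcomm ⟨a, (le_sup_left : X ≤ _) ha⟩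
      ⟨x, (le_sup_right : Subgroup.zpowers x ≤ _) (Subgroup.mem_zpowers x)⟩)
  · have hsn : s ∈ n.primeFactors :=
      Nat.mem_primeFactors.2 ⟨hs, hsA.trans (A.card_subgroup_dvd_card.trans hG), hn⟩
    have h1 : (MulAut.conjNormal x : MulAut X) = 1 :=
      hc.mulAut_eq_one hsn (Nat.mem_primeFactors.2 ⟨hp, hpn, hn⟩) (Ne.symm hsp) (hps s hs hsA hsp) hk
        (hs.le_factorization_of_card_eq hn hk (X.card_subgroup_dvd_card.trans hG)) _
        (t := t) (by rw [← map_pow, hx, map_one])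
    have h2 := congrArg Subtype.val (DFunLike.congr_fun h1 (⟨a, ha⟩ : X))
    rw [MulAut.conjNormal_apply] at h2
    exact (mul_inv_eq_iff_eq_mul.1 h2).symm

/-- The cofactor `1 + q + ⋯ + q ^ (j - 1)` is congruent to `j` modulo `p`, hence prime to `p`. -/
theorem Nat.Prime.pow_dvd_sub_one_of_dvd_pow_sub_one {p q j k : ℕ} (hp : p.Prime) (hq : 0 < q)
    (hpq : p ∣ q - 1) (hj : j ≠ 0) (hjp : j < p) (h : p ^ k ∣ q ^ j - 1) : p ^ k ∣ q - 1 := by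
  obtain ⟨c, hc⟩ := hpq
  obtain rfl : q = p * c + 1 := by omega
  have h2 : (∑ i ∈ Finset.range j, (p * c + 1) ^ i) ≡ ∑ i ∈ Finset.range j, 1 [MOD p] := by
    refine Nat.ModEq.sum fun i _ => ?_
    have : p * c + 1 ≡ 1 [MOD p] := by simp [Nat.ModEq]
    simpa using this.pow i
  have h3 : ¬ p ∣ ∑ i ∈ Finset.range j, (p * c + 1) ^ i := by
    rw [h2.dvd_iff dvd_rfl]
    simpa using Nat.not_dvd_of_pos_of_lt (Nat.pos_of_ne_zero hj) hjp
  have h4 := geom_sum_mul_add (p * c) j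
  have h5 : (p * c + 1) ^ j - 1 = (∑ i ∈ Finset.range j, (p * c + 1) ^ i) * (p * c) := by omega
  rw [h5] at h
  have := (((hp.coprime_iff_not_dvd).2 h3).pow_left k).dvd_of_dvd_mul_left h
  simpa using this

/-! ### Irreducible linear groups in characteristic `q` under the criterion. -/

section

variable {N : Type*} [Group N] [Finite N] {n q d : ℕ} {H : Subgroup (MulAut N)}

theorem SupersolvableCriterion.dvd_sub_one_of_dvd_card_mulAut (hc : SupersolvableCriterion n)
    (hq : q ∈ n.primeFactors) (hN : Nat.card N = q ^ d) (hd : d ≤ n.factorization q)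
    (hH : Nat.card H ∣ n) {r : ℕ} (hr : r.Prime) (hrH : r ∣ Nat.card H) (hrq : r ≠ q) :
    r ∣ q - 1 := by
  have : Fact r.Prime := ⟨hr⟩
  obtain ⟨f, hf⟩ := exists_prime_orderOf_dvd_card' r hrH
  exact hc.dvd_sub_one_of_orderOf_mulAut hq
    (Nat.mem_primeFactors.2 ⟨hr, hrH.trans hH, (Nat.mem_primeFactors.1 hq).2.2⟩) hrq hN hd f
    (by rw [Subgroup.orderOf_coe, hf])

/-- An abelian normal subgroup of an irreducible linear group in characteristic `q` has order
prime to `q`. -/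
theorem not_dvd_card_of_irreducible (hq : q.Prime) (hN : Nat.card N = q ^ d)
    (hirr : ∀ M : Subgroup N, (∀ h ∈ H, ∀ x ∈ M, h x ∈ M) → M = ⊥ ∨ M = ⊤)
    (A : Subgroup H) [A.Normal] [IsMulCommutative A] : ¬ q ∣ Nat.card A := by
  intro hqA
  have : Fact q.Prime := ⟨hq⟩
  obtain ⟨a₀, ha₀⟩ := exists_prime_orderOf_dvd_card' q hqA
  -- `Q` consists of the elements of `A` killed by `q`. It is stable under conjugation by `H`, so
  -- its fixed points form an invariant subgroup `M`. Counting modulo `q` rules out `M = ⊥`, and `M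
  -- = ⊤` would make `a₀` trivial.
  let Q : Subgroup (MulAut N) :=
    { carrier := {f | ∃ a : A, ((a : H) : MulAut N) = f ∧ a ^ q = 1}
      one_mem' := ⟨1, rfl, one_pow q⟩
      mul_mem' := by
        rintro _ _ ⟨a, rfl, ha⟩ ⟨b, rfl, hb⟩
        refine ⟨a * b, rfl, ?_⟩
        rw [(show Commute a b from mul_comm' a b).mul_pow, ha, hb, one_mul]
      inv_mem' := by
        rintro _ ⟨a, rfl, ha⟩
        exact ⟨a⁻¹, rfl, by rw [inv_pow, ha, inv_one]⟩ }
  have hQ : IsPGroup q Q := by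
    rintro ⟨_, a, rfl, ha⟩
    refine ⟨1, Subtype.ext ?_⟩
    rw [pow_one]
    exact congrArg (fun a : A => ((a : H) : MulAut N)) ha
  let M : Subgroup N :=
    { carrier := MulAction.fixedPoints Q N
      one_mem' := fun g => map_one (g : MulAut N)
      mul_mem' := fun {a b} ha hb g => by
        change (g : MulAut N) (a * b) = a * b
        rw [map_mul]
        exact congrArg₂ _ (ha g) (hb g)
      inv_mem' := fun {a} ha g => by
        change (g : MulAut N) a⁻¹ = a⁻¹
        rw [map_inv]
        exact congrArg _ (ha g) }
  have hMQ : ∀ x ∈ M, ∀ f ∈ Q, f x = x := fun x hx f hf => hx ⟨f, hf⟩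
  have hinv : ∀ h ∈ H, ∀ x ∈ M, h x ∈ M := by
    intro h hh x hx
    rintro ⟨_, a, rfl, ha⟩
    let b : A := MulAut.conjNormal (⟨h, hh⟩ : H)⁻¹ a
    have hb : ((b : H) : MulAut N) = h⁻¹ * ((a : H) : MulAut N) * h := by
      have := MulAut.conjNormal_apply (⟨h, hh⟩ : H)⁻¹ a
      rw [inv_inv] at this
      exact congrArg Subtype.val this
    have h1 := hMQ x hx _ ⟨b, rfl, by rw [← map_pow, ha, map_one]⟩
    rw [hb] at h1
    have h2 : h ((h⁻¹ * ((a : H) : MulAut N) * h) x) = ((a : H) : MulAut N) (h x) := by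
      rw [← MulAut.mul_apply, ← mul_assoc, mul_inv_cancel_left, MulAut.mul_apply]
    change ((a : H) : MulAut N) (h x) = h x
    rw [← h2, h1]
  rcases hirr M hinv with hM | hM
  · have h1 := hQ.card_modEq_card_fixedPoints N
    change _ ≡ Nat.card M [MOD q] at h1
    rw [hM, Subgroup.card_bot, hN] at h1
    rcases Nat.eq_zero_or_pos d with rfl | hd
    · rw [pow_zero, Nat.card_eq_one_iff_unique] at hN
      have := hN.1
      have : a₀ = 1 := Subtype.ext (Subtype.ext (MulEquiv.ext fun x => Subsingleton.elim _ _))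
      rw [this, orderOf_one] at ha₀
      exact hq.one_lt.ne ha₀
    · have h2 : q ^ d ≡ 0 [MOD q] := Nat.modEq_zero_iff_dvd.2 (dvd_pow_self q hd.ne')
      have := Nat.modEq_zero_iff_dvd.1 (h1.symm.trans h2)
      exact hq.one_lt.ne' (Nat.dvd_one.1 this)
  · have : a₀ = 1 := Subtype.ext <| Subtype.ext <| MulEquiv.ext fun x =>
      hMQ x (hM ▸ Subgroup.mem_top x) _ ⟨a₀, rfl, ha₀ ▸ pow_orderOf_eq_one a₀⟩
    rw [this, orderOf_one] at ha₀
    exact hq.one_lt.ne ha₀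

/-- The prime divisors of the index of a self-centralizing abelian normal subgroup exceed the
degree. -/
theorem SupersolvableCriterion.lt_of_prime_dvd_index (hc : SupersolvableCriterion n)
    (hq : q ∈ n.primeFactors) (hN : Nat.card N = q ^ d) (hd : d ≤ n.factorization q)
    (hH : Nat.card H ∣ n)
    (hirr : ∀ M : Subgroup N, (∀ h ∈ H, ∀ x ∈ M, h x ∈ M) → M = ⊥ ∨ M = ⊤)
    (A : Subgroup H) [A.Normal] [IsMulCommutative A]
    (hA : Subgroup.centralizer (A : Set H) ≤ A) {p : ℕ} (hp : p.Prime) (hpA : p ∣ A.index) :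
    d < p := by
  have hn : n ≠ 0 := (Nat.mem_primeFactors.1 hq).2.2
  have hq' := Nat.prime_of_mem_primeFactors hq
  have hpH : p ∣ Nat.card H := hpA.trans A.index_dvd_card
  have hqA := not_dvd_card_of_irreducible hq' hN hirr A
  have hAq : ∀ s : ℕ, s.Prime → s ∣ Nat.card A → s ∣ q - 1 := fun s hs hsA =>
    hc.dvd_sub_one_of_dvd_card_mulAut hq hN hd hH hs (hsA.trans A.card_subgroup_dvd_card)
      (by rintro rfl; exact hqA hsA)
  have : Fact p.Prime := ⟨hp⟩
  by_contra! hpd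
  obtain ⟨P⟩ : Nonempty (Sylow p H) := inferInstance
  -- If `p ≤ d`, the Sylow subgroup `P` centralizes `A` and so lies in it. For `p = q` this is
  -- because primes dividing the order of `A` are smaller than `q`; for `p ≠ q` it is the content of
  -- the conditions triggered by `p ≤ n.factorization q`.
  refine P.not_dvd_index (hpA.trans (Subgroup.index_dvd_of_le fun x hx => hA ?_))
  obtain ⟨t, ht⟩ := P.2 ⟨x, hx⟩
  have ht' : x ^ p ^ t = 1 := congrArg Subtype.val ht
  by_cases hpq : p = q
  · subst hpq
    refine hc.mem_centralizer hn hH A hp (hpH.trans hH) (fun s hs hsA _ hps => ?_)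
      (fun h => absurd h hqA) ht'
    have h1 := Nat.le_of_dvd (Nat.sub_pos_of_lt hp.one_lt) (hAq s hs hsA)
    have h2 := Nat.le_of_dvd (Nat.sub_pos_of_lt hs.one_lt) hps
    have := hp.two_le
    have := hs.two_le
    omega
  · have hpn : p ∈ n.primeFactors := Nat.mem_primeFactors.2 ⟨hp, hpH.trans hH, hn⟩
    refine hc.mem_centralizer hn hH A hp (hpH.trans hH) (fun s hs hsA _ hps => ?_)
      (fun _ => (hc.exponent_condition p hpn q hq hpq (hpd.trans hd)).1) ht'
    exact hc.no_intermediate p hpn q hq hpq (hpd.trans hd)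
      ⟨s, Nat.mem_primeFactors.2 ⟨hs, (hsA.trans A.card_subgroup_dvd_card).trans hH, hn⟩, hps,
        hAq s hs hsA⟩

/-- One prime power `p ^ k` at a time: for `p ≤ d` the exponent condition applies directly; for `p >
d` a free action gives `p ^ k ∣ q ^ j - 1` with `j ≤ d < p`, and the exponent `j` can be removed. -/
theorem SupersolvableCriterion.orderOf_dvd_sub_one (hc : SupersolvableCriterion n)
    (hq : q ∈ n.primeFactors) (hN : Nat.card N = q ^ d) (hd : d ≤ n.factorization q)
    (hH : Nat.card H ∣ n) {a : MulAut N} (ha : a ∈ H) (hqa : ¬ q ∣ orderOf a) :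
    orderOf a ∣ q - 1 := by
  have hn : n ≠ 0 := (Nat.mem_primeFactors.1 hq).2.2
  have hq' := Nat.prime_of_mem_primeFactors hq
  have haH : orderOf a ∣ Nat.card H := Subgroup.orderOf_dvd_natCard H ha
  refine (Nat.dvd_iff_prime_pow_dvd_dvd _ _).2 fun p k hp hpk => ?_
  rcases k with _ | k
  · simp
  have hpa : p ∣ orderOf a := (dvd_pow_self p (Nat.succ_ne_zero k)).trans hpk
  have hpq : p ≠ q := by rintro rfl; exact hqa hpa
  have hpq1 := hc.dvd_sub_one_of_dvd_card_mulAut hq hN hd hH hp (hpa.trans haH) hpq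
  have hpn : p ∈ n.primeFactors := Nat.mem_primeFactors.2 ⟨hp, (hpa.trans haH).trans hH, hn⟩
  by_cases hpd : p ≤ d
  · obtain ⟨h1, h2⟩ := hc.exponent_condition p hpn q hq hpq (hpd.trans hd)
    have hk : k + 1 ≤ n.factorization p :=
      (hp.pow_dvd_iff_le_factorization hn).1 ((hpk.trans haH).trans hH)
    rcases k with _ | k
    · simpa using hpq1
    · obtain rfl : k = 0 := by omega
      exact h2 (by omega)
  · obtain ⟨c, hc'⟩ := hpk
    have hc0 : c ≠ 0 := by
      rintro rfl
      exact (orderOf_pos a).ne' (hc'.trans (mul_zero _))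
    have ho : orderOf (a ^ c) = p ^ (k + 1) := by
      rw [orderOf_pow_of_dvd hc0 (hc' ▸ dvd_mul_left _ _), hc',
        Nat.mul_div_cancel _ (Nat.pos_of_ne_zero hc0)]
    obtain ⟨j, hj, hjd, hdj⟩ :=
      exists_prime_pow_dvd_pow_sub_one_of_orderOf_mulAut hp hq' hpq hN (a ^ c) ho
    exact hp.pow_dvd_sub_one_of_dvd_pow_sub_one hq'.pos hpq1 hj (by omega) hdj

end

/-! ### Weight spaces and the reduction to dimension one. -/

open Module.End in
-- Let `W` be a minimal nonzero invariant subspace. Each `f i` has an eigenvector in `W`, as its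
-- minimal polynomial there divides the split polynomial `X ^ |K| - X`. Its eigenspace meets `W` in
-- an invariant subspace, hence contains `W`.
theorem exists_iInf_eigenspace_ne_bot {K V ι : Type*} [Field K] [Fintype K] [AddCommGroup V]
    [Module K V] [FiniteDimensional K V] [Nontrivial V] (f : ι → Module.End K V)
    (hcomm : ∀ i j, Commute (f i) (f j)) (hf : ∀ i, f i ^ Fintype.card K = f i) :
    ∃ χ : ι → K, ⨅ i, (f i).eigenspace (χ i) ≠ ⊥ := by
  obtain ⟨W, hW⟩ := exists_minimal_of_wellFoundedLT
    (fun W : Submodule K V => W ≠ ⊥ ∧ ∀ i, ∀ w ∈ W, f i w ∈ W) ⟨⊤, top_ne_bot, by simp⟩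
  obtain ⟨hb, hinv⟩ := hW.prop
  have key : ∀ i, ∃ c : K, W ≤ (f i).eigenspace c := by
    intro i
    have : Nontrivial W := Submodule.nontrivial_iff_ne_bot.2 hb
    let T : Module.End K W := (f i).restrict (hinv i)
    have hT : Polynomial.aeval T (Polynomial.X ^ Fintype.card K - Polynomial.X : Polynomial K) = 0 := by
      rw [map_sub, map_pow, Polynomial.aeval_X, sub_eq_zero]
      ext w
      rw [Module.End.pow_restrict, LinearMap.coe_restrict_apply, hf]
      rfl
    have hX : (Polynomial.X ^ Fintype.card K - Polynomial.X : Polynomial K).Splits := by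
      rw [Polynomial.splits_iff_card_roots, FiniteField.roots_X_pow_card_sub_X,
        FiniteField.X_pow_card_sub_X_natDegree_eq K Fintype.one_lt_card]
      rfl
    have hs : (minpoly K T).Splits :=
      hX.of_dvd
        (FiniteField.X_pow_card_sub_X_ne_zero K Fintype.one_lt_card) (minpoly.dvd K T hT)
    obtain ⟨c, hc⟩ := hs.exists_eval_eq_zero
      (minpoly.degree_pos (Algebra.IsIntegral.isIntegral T)).ne'
    obtain ⟨w, hw⟩ := (Module.End.hasEigenvalue_of_isRoot hc).exists_hasEigenvector
    refine ⟨c, ?_⟩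
    have h1 : (f i) w = c • (w : V) := congrArg Subtype.val hw.apply_eq_smul
    have h2 : W ⊓ (f i).eigenspace c ≠ ⊥ := by
      intro h
      have : (w : V) ∈ W ⊓ (f i).eigenspace c := ⟨w.2, mem_eigenspace_iff.2 h1⟩
      rw [h, Submodule.mem_bot] at this
      exact hw.2 (Subtype.ext this)
    refine (hW.le_of_le ⟨h2, fun j v hv => ⟨hinv j v hv.1, ?_⟩⟩ inf_le_left).trans inf_le_right
    rw [SetLike.mem_coe, mem_eigenspace_iff]
    rw [← Module.End.mul_apply, (hcomm i j).eq, Module.End.mul_apply, mem_eigenspace_iff.1 hv.2,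
      map_smul]
  choose χ hχ using key
  exact ⟨χ, fun h => hb (le_bot_iff.1 (h ▸ le_iInf hχ))⟩

theorem iSupIndep_iInf_eigenspace {K V ι : Type*} [Field K] [AddCommGroup V] [Module K V]
    (f : ι → Module.End K V) (hcomm : ∀ i j, Commute (f i) (f j)) :
    iSupIndep fun χ : ι → K => ⨅ i, (f i).eigenspace (χ i) := by
  have h := Module.End.independent_iInf_maxGenEigenspace_of_forall_mapsTo f
    fun i j φ => Module.End.mapsTo_maxGenEigenspace_of_comm (hcomm j i) φ
  refine h.mono fun χ => iInf_mono fun i => ?_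
  intro v hv
  rw [Module.End.mem_maxGenEigenspace]
  exact ⟨1, by simpa [sub_eq_zero] using Module.End.mem_eigenspace_iff.1 hv⟩

theorem exists_monoidHom_end {N V : Type*} [Group N] [AddCommGroup V] {q : ℕ} [Module (ZMod q) V]
    (e : Additive N ≃+ V) : ∃ T : MulAut N →* Module.End (ZMod q) V,
      ∀ (h : MulAut N) (x : N), T h (e (Additive.ofMul x)) = e (Additive.ofMul (h x)) := by
  let F : MulAut N → V →+ V := fun h => e.toAddMonoidHom.comp
    ((MonoidHom.toAdditive h.toMonoidHom).comp e.symm.toAddMonoidHom)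
  have hF : ∀ h (x : N), F h (e (Additive.ofMul x)) = e (Additive.ofMul (h x)) := fun h x =>
    congrArg (fun y => e (Additive.ofMul (h y.toMul))) (e.symm_apply_apply (Additive.ofMul x))
  have he : ∀ v, ∃ x : N, v = e (Additive.ofMul x) := fun v =>
    ⟨(e.symm v).toMul, (e.apply_symm_apply v).symm⟩
  refine ⟨{ toFun := fun h => AddMonoidHom.toZModLinearMap q (F h), map_one' := ?_, map_mul' := ?_ },
    fun h x => hF h x⟩
  · ext v
    obtain ⟨x, rfl⟩ := he v
    rw [AddMonoidHom.coe_toZModLinearMap, hF]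
    rfl
  · intro g h
    ext v
    obtain ⟨x, rfl⟩ := he v
    rw [Module.End.mul_apply, AddMonoidHom.coe_toZModLinearMap, AddMonoidHom.coe_toZModLinearMap,
      AddMonoidHom.coe_toZModLinearMap, hF, hF, hF]
    rfl

/-- An irreducible linear group `H` over the field with `q` elements is one-dimensional if it has a
self-centralizing abelian normal subgroup `A` of exponent dividing `q - 1` such that the prime
divisors of the index of `A` exceed the dimension. -/
theorem isCyclic_of_irreducible {N V : Type*} [Group N] [Finite N] [AddCommGroup V] {q d : ℕ}
    [Fact q.Prime] [Module (ZMod q) V] [Finite V] (e : Additive N ≃+ V)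
    (hN : Nat.card N = q ^ d) {H : Subgroup (MulAut N)}
    (hirr : ∀ M : Subgroup N, (∀ h ∈ H, ∀ x ∈ M, h x ∈ M) → M = ⊥ ∨ M = ⊤)
    (A : Subgroup H) [A.Normal] [IsMulCommutative A]
    (hA : Subgroup.centralizer (A : Set H) ≤ A) (hAq : ∀ a ∈ A, a ^ (q - 1) = 1)
    (hidx : ∀ p : ℕ, p.Prime → p ∣ A.index → d < p) : IsCyclic N := by
  cases subsingleton_or_nontrivial N
  · infer_instance
  have hq : q.Prime := Fact.out
  have : Nontrivial V := e.symm.toEquiv.nontrivial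
  obtain ⟨T₀, hT₀⟩ := exists_monoidHom_end (q := q) e
  let T : H →* Module.End (ZMod q) V := T₀.comp H.subtype
  have hT : ∀ (h : H) (x : N), T h (e (Additive.ofMul x)) = e (Additive.ofMul ((h : MulAut N) x)) :=
    fun h x => hT₀ h x
  clear_value T
  have hrank : Module.finrank (ZMod q) V = d := by
    have h1 := Module.natCard_eq_pow_finrank (K := ZMod q) (V := V)
    rw [Nat.card_zmod, ← Nat.card_congr e.toEquiv] at h1
    exact (Nat.pow_right_injective hq.two_le (hN.symm.trans h1)).symm
  let E : (A → ZMod q) → Submodule (ZMod q) V :=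
    fun χ => ⨅ a : A, (T a).eigenspace (χ a)
  have hE : ∀ χ v, v ∈ E χ ↔ ∀ a : A, T a v = χ a • v := by
    intro χ v
    simp [E, Submodule.mem_iInf]
  have hcomm : ∀ a b : A, Commute (T a) (T b) := fun a b =>
    (show Commute (a : H) b from congrArg Subtype.val (mul_comm' a b)).map T
  obtain ⟨χ, hχ⟩ : ∃ χ, E χ ≠ ⊥ := by
    refine exists_iInf_eigenspace_ne_bot (fun a : A => T a) hcomm fun a => ?_
    rw [ZMod.card, ← map_pow]
    congr 1
    obtain ⟨m, rfl⟩ : ∃ m, q = m + 1 := ⟨q - 1, by have := hq.pos; omega⟩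
    rw [pow_succ]
    have := hAq a a.2
    rw [Nat.add_sub_cancel] at this
    rw [this, one_mul]
  have hind : iSupIndep E := iSupIndep_iInf_eigenspace (fun a : A => T a) hcomm
  -- `H` acts on weights by conjugation, and `T h` carries `E χ` into `E (h • χ)`.
  let act : MulAction H (A → ZMod q) :=
    { smul := fun h χ a => χ (MulAut.conjNormal h⁻¹ a)
      one_smul := fun χ => by
        funext a
        change χ (MulAut.conjNormal 1⁻¹ a) = χ a
        simp
      mul_smul := fun g h χ => by
        funext a
        change χ (MulAut.conjNormal (g * h)⁻¹ a) =
          χ (MulAut.conjNormal h⁻¹ (MulAut.conjNormal g⁻¹ a))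
        rw [mul_inv_rev, map_mul, MulAut.mul_apply] }
  have hsmul : ∀ (h : H) (χ : A → ZMod q) (a : A), (h • χ) a = χ (MulAut.conjNormal h⁻¹ a) :=
    fun _ _ _ => rfl
  have hmap : ∀ (h : H) (χ : A → ZMod q) v, v ∈ E χ → T h v ∈ E (h • χ) := by
    intro h χ v hv
    rw [hE] at hv ⊢
    intro a
    have h1 : (a : H) * h = h * (MulAut.conjNormal h⁻¹ a : A) := by
      rw [MulAut.conjNormal_apply]
      group
    rw [← Module.End.mul_apply, ← map_mul, h1, map_mul, Module.End.mul_apply, hv, map_smul, hsmul]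
  -- The weights in the orbit have nonzero, independent weight spaces in a space of dimension `d`.
  have horb : Nat.card (MulAction.orbit H χ) ≤ d := by
    have : Fintype {χ // E χ ≠ ⊥} := hind.fintypeNeBotOfFiniteDimensional
    have h1 := hind.subtype_ne_bot_le_finrank
    rw [hrank, ← Nat.card_eq_fintype_card] at h1
    refine le_trans ?_ h1
    refine Nat.card_le_card_of_injective
      (fun ψ : MulAction.orbit H χ => (⟨ψ, ?_⟩ : {χ // E χ ≠ ⊥})) ?_
    · obtain ⟨ψ, h, rfl⟩ := ψ
      obtain ⟨v, hv, hv0⟩ := Submodule.exists_mem_ne_zero_of_ne_bot hχ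
      intro h0
      have h2 := hmap h χ v hv
      change T h v ∈ E (h • χ) at h2
      change E (h • χ) = ⊥ at h0
      rw [h0, Submodule.mem_bot] at h2
      apply hv0
      rw [← Module.End.one_apply (R := ZMod q) v, ← map_one T, ← inv_mul_cancel h, map_mul,
        Module.End.mul_apply, h2, map_zero]
    · intro a b hab
      have h1 := congrArg (fun z : {χ // E χ ≠ ⊥} => z.1) hab
      exact Subtype.ext h1
  -- The stabilizer contains the abelian group `A`, so a prime dividing its index exceeds `d`, while
  -- the index is the orbit length.
  have hstab : MulAction.stabilizer H χ = ⊤ := by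
    by_contra hne
    rw [← Subgroup.index_eq_one] at hne
    have hp := Nat.minFac_prime hne
    have hle : A ≤ MulAction.stabilizer H χ := by
      intro a ha
      rw [MulAction.mem_stabilizer_iff]
      funext b
      rw [hsmul]
      congr 1
      apply Subtype.ext
      rw [MulAut.conjNormal_apply, inv_inv, mul_assoc, inv_mul_eq_iff_eq_mul]
      exact congrArg Subtype.val (mul_comm' b ⟨a, ha⟩)
    have h1 := hidx _ hp ((Nat.minFac_dvd _).trans (Subgroup.index_dvd_of_le hle))
    have h2 := Nat.minFac_le (Nat.pos_of_ne_zero (MulAction.stabilizer H χ).index_ne_zero_of_finite)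
    rw [MulAction.index_stabilizer] at h1 h2
    rw [← Nat.card_coe_set_eq] at h1 h2
    omega
  have hEtop : ∀ v, v ∈ E χ := by
    let M : Subgroup N :=
      { carrier := {x | e (Additive.ofMul x) ∈ E χ}
        one_mem' := by
          change e 0 ∈ E χ
          rw [map_zero]
          exact zero_mem _
        mul_mem' := fun {a b} ha hb => by
          change e (Additive.ofMul a + Additive.ofMul b) ∈ E χ
          rw [map_add]
          exact add_mem ha hb
        inv_mem' := fun {a} ha => by
          change e (-Additive.ofMul a) ∈ E χ
          rw [map_neg]
          exact neg_mem ha }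
    have hM : ∀ v, v ∈ E χ ↔ (e.symm v).toMul ∈ M := fun v => by
      change _ ↔ e (e.symm v) ∈ E χ
      rw [e.apply_symm_apply]
    have hinv : ∀ h ∈ H, ∀ x ∈ M, h x ∈ M := by
      intro h hh x hx
      have h1 := hmap ⟨h, hh⟩ χ _ hx
      rwa [(hstab ▸ Subgroup.mem_top _ : (⟨h, hh⟩ : H) ∈ MulAction.stabilizer H χ), hT] at h1
    rcases hirr M hinv with h | h
    · obtain ⟨v, hv, hv0⟩ := Submodule.exists_mem_ne_zero_of_ne_bot hχ
      rw [hM, h, Subgroup.mem_bot] at hv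
      exact absurd ((AddEquiv.map_eq_zero_iff e.symm).1 hv) hv0
    · intro v
      rw [hM, h]
      exact Subgroup.mem_top _
  have hTinj : Function.Injective T := by
    intro g h hgh
    apply Subtype.ext
    ext x
    have h1 : T g (e (Additive.ofMul x)) = T h (e (Additive.ofMul x)) := by rw [hgh]
    rw [hT, hT] at h1
    exact e.injective h1
  -- `A` acts by scalars, so it is central in `H`; being self-centralizing, it is all of `H`. Every
  -- cyclic subgroup of `N` is then invariant.
  have hAtop : ∀ h : H, h ∈ A := by
    intro h
    refine hA (Subgroup.mem_centralizer_iff.2 fun a ha => hTinj ?_)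
    ext v
    rw [map_mul, map_mul, Module.End.mul_apply, Module.End.mul_apply,
      (hE χ _).1 (hEtop _) ⟨a, ha⟩, (hE χ _).1 (hEtop v) ⟨a, ha⟩, map_smul]
  obtain ⟨x, hx⟩ := exists_ne (1 : N)
  have hinv : ∀ h ∈ H, ∀ y ∈ Subgroup.zpowers x, h y ∈ Subgroup.zpowers x := by
    intro h hh y hy
    have h1 := (hE χ _).1 (hEtop (e (Additive.ofMul y))) ⟨⟨h, hh⟩, hAtop _⟩
    rw [hT, ← ZMod.natCast_zmod_val (χ _), Nat.cast_smul_eq_nsmul, ← map_nsmul] at h1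
    have h2 : h y = y ^ (χ ⟨⟨h, hh⟩, hAtop _⟩).val := e.injective h1
    rw [h2]
    exact Subgroup.pow_mem _ hy _
  rcases hirr (Subgroup.zpowers x) hinv with h | h
  · exact absurd (Subgroup.zpowers_eq_bot.1 h) hx
  · exact ⟨x, fun y => (h ▸ Subgroup.mem_top y : y ∈ Subgroup.zpowers x)⟩

/-- A group all of whose quotients are supersolvable has a self-centralizing abelian normal
subgroup. -/
theorem exists_centralizer_le {H : Type*} [Group H] [Finite H]
    (hs : ∀ A : Subgroup H, ∀ _ : A.Normal, IsSupersolvable (H ⧸ A)) :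
    ∃ A : Subgroup H, A.Normal ∧ IsMulCommutative A ∧ Subgroup.centralizer (A : Set H) ≤ A := by
  obtain ⟨A, hA⟩ := (Set.toFinite {A : Subgroup H | A.Normal ∧ IsMulCommutative A}).exists_maximal
    ⟨⊥, inferInstance, inferInstance⟩
  obtain ⟨hn, hc⟩ := hA.prop
  refine ⟨A, hn, hc, ?_⟩
  by_contra hle
  have hAC : A ≤ Subgroup.centralizer (A : Set H) := Subgroup.le_centralizer_iff_isMulCommutative.2 hc
  -- Take `A` maximal among abelian normal subgroups. If `C ≠ ⊥`, it contains a nontrivial cyclic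
  -- normal subgroup of `H ⧸ A`, generated by the image of some `b` centralizing `A`; its preimage
  -- `B` is abelian, normal and larger than `A`.
  let C := (Subgroup.centralizer (A : Set H)).map (QuotientGroup.mk' A)
  have hCn : C.Normal := Subgroup.Normal.map inferInstance _ (QuotientGroup.mk'_surjective A)
  have hC : C ≠ ⊥ := by
    intro h
    rw [Subgroup.map_eq_bot_iff, QuotientGroup.ker_mk'] at h
    exact hle h
  obtain ⟨_, ⟨b, hb, rfl⟩, hb1, hbn⟩ := (hs A hn).exists_zpowers_normal C hC
  let B := (Subgroup.zpowers (QuotientGroup.mk' A b)).comap (QuotientGroup.mk' A)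
  have hmem : ∀ x ∈ B, ∃ (k : ℤ), ∃ a ∈ A, x = b ^ k * a := by
    rintro x ⟨k, hk⟩
    refine ⟨k, (b ^ k)⁻¹ * x, ?_, by group⟩
    rw [← QuotientGroup.eq]
    exact hk
  have hBn : B.Normal := hbn.comap _
  have hBc : IsMulCommutative B := by
    rw [isMulCommutative_iff_of_setLike]
    intro x hx y hy
    obtain ⟨k, a, ha, rfl⟩ := hmem x hx
    obtain ⟨l, a', ha', rfl⟩ := hmem y hy
    have h1 : ∀ a ∈ A, ∀ k : ℤ, Commute a (b ^ k) := fun a ha k =>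
      Commute.zpow_right ((Subgroup.mem_centralizer_iff.1 hb) a ha) k
    have h2 : Commute a a' := isMulCommutative_iff_of_setLike.1 hc a ha a' ha'
    have h3 : Commute (b ^ k) (b ^ l) := Commute.zpow_zpow_self b k l
    exact ((h3.mul_right (h1 a' ha' k).symm).mul_left ((h1 a ha l).mul_right h2)).eq
  have hAB : A ≤ B := fun a ha => by
    have : QuotientGroup.mk' A a = 1 := (QuotientGroup.eq_one_iff a).2 ha
    change QuotientGroup.mk' A a ∈ Subgroup.zpowers (QuotientGroup.mk' A b)
    rw [this]
    exact one_mem _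
  refine hb1 ((QuotientGroup.eq_one_iff b).2 (hA.le_of_ge ⟨hBn, hBc⟩ hAB ?_))
  exact Subgroup.mem_zpowers _

/-! ### Sufficiency: the induction on the order. -/

theorem SupersolvableCriterion.isSupersolvableNumber {n : ℕ} (hc : SupersolvableCriterion n)
    (hn : n ≠ 0) : IsSupersolvableNumber.{u} n := by
  induction n using Nat.strong_induction_on with
  | _ n ih =>
  intro G _ hG
  have ih' : ∀ (m : ℕ), m ∣ n → m < n → IsSupersolvableNumber.{u} m := fun m hm hlt =>
    ih m hlt (hc.of_dvd hn hm) (ne_zero_of_dvd_ne_zero hn hm)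
  have : Finite G := Nat.finite_of_card_ne_zero (hG ▸ hn)
  cases subsingleton_or_nontrivial G
  · exact IsSupersolvable.of_subsingleton
  have := hc.isSolvable hn G hG
  obtain ⟨N, hNn, hNb, hNc, hmin⟩ := exists_isMulCommutative_minimal_normal G
  have hNt : Nontrivial N := (Subgroup.nontrivial_iff_ne_bot N).2 hNb
  have hq : (Nat.card N).minFac.Prime := Nat.minFac_prime (Finite.one_lt_card (α := N)).ne'
  set q := (Nat.card N).minFac with hqdef
  have : Fact q.Prime := ⟨hq⟩
  let φ : G →* MulAut N := MulAut.conjNormal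
  have hinv : ∀ M : Subgroup N, (∀ h ∈ φ.range, ∀ x ∈ M, h x ∈ M) → M = ⊥ ∨ M = ⊤ := by
    intro M hM
    have h1 : (M.map N.subtype).Normal := by
      refine ⟨?_⟩
      rintro _ ⟨x, hx, rfl⟩ g
      exact ⟨φ g x, hM _ ⟨g, rfl⟩ x hx, MulAut.conjNormal_apply g x⟩
    rcases hmin _ h1 (Subgroup.map_subtype_le M) with h | h
    · left
      rwa [Subgroup.map_eq_bot_iff_of_injective _ N.subtype_injective] at h
    · right
      refine Subgroup.map_injective N.subtype_injective (h.trans ?_)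
      rw [← MonoidHom.range_eq_map, Subgroup.range_subtype]
  -- The elements killed by `q` form an invariant subgroup, nontrivial by Cauchy's theorem.
  have hexp : ∀ x : N, x ^ q = 1 := by
    let M : Subgroup N :=
      { carrier := {x | x ^ q = 1}
        one_mem' := one_pow q
        mul_mem' := fun {a b} ha hb => by
          change (a * b) ^ q = 1
          rw [(show Commute a b from mul_comm' a b).mul_pow, ha, hb, one_mul]
        inv_mem' := fun {a} ha => by
          change a⁻¹ ^ q = 1
          rw [inv_pow, ha, inv_one] }
    have hM : ∀ h ∈ φ.range, ∀ x ∈ M, h x ∈ M := fun h _ x hx => by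
      change h x ^ q = 1
      rw [← map_pow, (hx : x ^ q = 1), map_one]
    rcases hinv M hM with h | h
    · obtain ⟨x, hx⟩ := exists_prime_orderOf_dvd_card' (G := N) q (Nat.minFac_dvd _)
      have : x ∈ M := by
        change x ^ q = 1
        rw [← hx, pow_orderOf_eq_one]
      rw [h, Subgroup.mem_bot] at this
      rw [this, orderOf_one] at hx
      exact absurd hx hq.one_lt.ne
    · exact fun x => (h ▸ Subgroup.mem_top x : x ∈ M)
  obtain ⟨d, hd⟩ := IsPGroup.iff_card.1 (fun x : N => ⟨1, by rw [pow_one]; exact hexp x⟩ :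
    IsPGroup q N)
  have hNn' : Nat.card N ∣ n := hG ▸ N.card_subgroup_dvd_card
  have hqn : q ∈ n.primeFactors := Nat.mem_primeFactors.2 ⟨hq, (Nat.minFac_dvd _).trans hNn', hn⟩
  have hdn : d ≤ n.factorization q := hq.le_factorization_of_card_eq hn hd hNn'
  have hHn : Nat.card φ.range ∣ n := hG ▸ Subgroup.card_range_dvd φ
  -- The abelian group `N` acts trivially on itself, so `φ` is not injective and the induction
  -- hypothesis reaches the quotients of its range.
  have hHlt : Nat.card φ.range < n := by
    have h1 : N ≤ φ.ker := fun x hx => by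
      rw [MonoidHom.mem_ker]
      ext y
      rw [MulAut.conjNormal_apply]
      have := congrArg Subtype.val (mul_comm' (⟨x, hx⟩ : N) y)
      exact mul_inv_eq_of_eq_mul this
    have h2 : Nat.card φ.range * Nat.card φ.ker = n := by
      rw [← hG, ← φ.ker.card_mul_index, Subgroup.index_ker, mul_comm]
    have h3 : 1 < Nat.card φ.ker := (Finite.one_lt_card (α := N)).trans_le (Subgroup.card_le_of_le h1)
    rw [← h2]
    exact lt_mul_of_one_lt_right Nat.card_pos h3
  have hquot : ∀ A : Subgroup φ.range, ∀ _ : A.Normal, IsSupersolvable (φ.range ⧸ A) := by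
    intro A _
    have h1 : Nat.card (φ.range ⧸ A) ∣ Nat.card φ.range := A.card_quotient_dvd_card
    exact ih' _ (h1.trans hHn) ((Nat.le_of_dvd Nat.card_pos h1).trans_lt hHlt) _ rfl
  obtain ⟨A, hAn, hAc, hA⟩ := exists_centralizer_le hquot
  have hqA := not_dvd_card_of_irreducible hq hd hinv A
  let _ : CommGroup N := { (inferInstance : Group N) with mul_comm := mul_comm' }
  have hcyc : IsCyclic N := by
    let _ : AddCommGroup (Additive N) := Additive.addCommGroup
    let _ : Module (ZMod q) (Additive N) := AddCommGroup.zmodModule hexp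
    refine isCyclic_of_irreducible (V := Additive N) (AddEquiv.refl _) hd hinv A hA
      (fun a ha => ?_) fun p hp hpA => hc.lt_of_prime_dvd_index hqn hd hdn hHn hinv A hA hp hpA
    have h1 : ¬ q ∣ orderOf (a : MulAut N) := fun h => hqA <| h.trans <| by
      rw [Subgroup.orderOf_coe]
      exact Subgroup.orderOf_dvd_natCard A ha
    have h2 := hc.orderOf_dvd_sub_one hqn hd hdn hHn a.2 h1
    exact Subtype.ext (orderOf_dvd_iff_pow_eq_one.1 h2)
  have hlt : Nat.card (G ⧸ N) < n := by
    rw [← hG, N.card_eq_card_quotient_mul_card_subgroup]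
    exact lt_mul_of_one_lt_right Nat.card_pos Finite.one_lt_card
  exact IsSupersolvable.of_isCyclic_of_quotient N
    (ih' _ (hG ▸ N.card_quotient_dvd_card) hlt _ rfl)

theorem mainTheorem6 (n : ℕ) (hn : 0 < n) :
    IsSupersolvableNumber.{u} n ↔ SupersolvableCriterion n :=
  ⟨SupersolvableCriterion.of_isSupersolvableNumber hn.ne',
    fun h => h.isSupersolvableNumber hn.ne'⟩
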